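/- Let $K$ be a field, $n\ge 0$, $A\subseteq\mathbb N^n$ a set of exponents, $I=(\mathbf x^{\mathbf a}:\mathbf a\in A)\subseteq K[\mathbf x]=K[x_1,\dots,x_n]$ the monomial ideal it generates, $\operatorname{supp}(I)=\{\mathbf a\in\mathbb N^n:\mathbf x^{\mathbf a}\in I\}$, and $N=\operatorname{conv}(\operatorname{supp}(I))\subseteq\mathbb R^n$ its Newton polyhedron. Let $\pi:\widetilde{\mathbb A}^n=\operatorname{Proj}\bigl(\bigoplus_{d\ge 0}I^dt^d\bigr)\to\mathbb A^n_K$ be the blowup of $\mathbb A^n$ in $I$. For $\mathbf a\in\operatorname{supp}(I)$ the $\mathbf a$-chart is the affine open subscheme $U_{\mathbf a}=D_+(\mathbf x^{\mathbf a}t)$ of $\widetilde{\mathbb A}^n$, i.e. $U_{\mathbf a}=\operatorname{Spec}K[\mathbf x][\mathbf x^{\mathbf a'-\mathbf a}:\mathbf a'\in A]$, considered as a scheme over $K$. The ideal tangent cone at $\mathbf a$ is the monoid $$IT_{\mathbf a}(I)={}_{\mathbb N}\langle \mathbf a'-\mathbf a:\ \mathbf a\ne\mathbf a'\in A\rangle+{}_{\mathbb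 N}\langle \mathbf e_1,\dots,\mathbf e_n\rangle\subseteq\mathbb Z^n .$$ A minimal generating set of $IT_{\mathbf a}(I)$ is a finite set $S$ that generates it as a monoid and in which no element is an $\mathbb N$-linear combination of the others; the elements of such a set are called minimal generators. The cone $IT_{\mathbf a}(I)$ is called simplicial if it is pointed, i.e. $IT_{\mathbf a}(I)\cap(-IT_{\mathbf a}(I))=\{0\}$, and its (then unique) minimal generating set has exactly $n$ elements. The real tangent cone $T_{\mathbf a}(N)$ is the cone in $\mathbb R^n$ generated by all $\mathbf p-\mathbf a$ with $\mathbf p\in N$. Then: (i) If $\mathbf a\in A$ is not a vertex of $N$, then the $\mathbf a$-chart is contained in the union of the charts $U_{\mathbf v}$ of $\widetilde{\mathbb A}^n$ with $\mathbf v\in A$ a vertex of $N$. (ii) If $\mathbf a$ is a vertex of $N$, then the $\mathbf a$-chart is smooth over $K$ if and only if $IT_{\mathbf a}(I)$ is simplicial. (iii) If $\mathbf a$ is a vertex of $N$ and $IT_{\mathbf a}(I)$ is simplicial, then every minimal generator of $IT_{\mathbf a}(I)$ is primitive (its coordinates are relatively prime) and $IT_{\mathbf a}(I)=T_{\mathbf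 a}(N)\cap\mathbb Z^n$. (iv) If $\mathbf a\in\operatorname{supp}(I)$ is such that all its neighboring lattice points $\mathbf a\pm\mathbf e_i$, $1\le i\le n$, are in $\operatorname{supp}(I)$, then the $\mathbf a$-chart is isomorphic over $K$ to the torus $(K^*)^n=\operatorname{Spec}K[z_1^{\pm1},\dots,z_n^{\pm1}]$. -/

import Mathlib

open CategoryTheory AlgebraicGeometry

universe u

noncomputable section

/-! ### The blowup of an affine scheme in an ideal -/

section Blowup

variable {R : Type u} [CommRing R] (I : Ideal R)

/-- The degree `d` part `Iᵈ tᵈ` of the Rees algebra `⨁ Iᵈ tᵈ ⊆ R[t]`. -/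
def reesGrading (d : ℕ) : Submodule R (reesAlgebra I) where
  carrier := {f | ∀ i, i ≠ d → (f : Polynomial R).coeff i = 0}
  add_mem' hf hg i hi := by simp [hf i hi, hg i hi]
  zero_mem' i _ := by simp
  smul_mem' r f hf i hi := by simp [hf i hi]

theorem mem_reesGrading {d : ℕ} {f : reesAlgebra I} :
    f ∈ reesGrading I d ↔ ∀ i, i ≠ d → (f : Polynomial R).coeff i = 0 := Iff.rfl

instance reesGrading_gradedMonoid : SetLike.GradedMonoid (reesGrading I) where
  one_mem := by
    intro i hi
    simp [Polynomial.coeff_one, hi]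
  mul_mem := by
    intro d e f g hf hg i hi
    rw [MulMemClass.coe_mul, Polynomial.coeff_mul]
    refine Finset.sum_eq_zero fun p hp => ?_
    by_cases h1 : p.1 = d
    · have h2 : p.2 ≠ e := by
        rintro rfl
        have hp' : p.1 + p.2 = i := Finset.HasAntidiagonal.mem_antidiagonal.mp hp
        exact hi (by rw [← hp', h1])
      rw [hg p.2 h2, mul_zero]
    · rw [hf p.1 h1, zero_mul]

/-- The degree `d` component of an element of the Rees algebra. -/
def reesComponent (f : reesAlgebra I) (d : ℕ) : reesGrading I d :=
  ⟨⟨Polynomial.monomial d ((f : Polynomial R).coeff d),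
      reesAlgebra.monomial_mem.mpr (f.2 d)⟩,
    fun _ hi => Polynomial.coeff_monomial_of_ne _ hi⟩

open scoped DirectSum in
theorem rees_coeff_sum (x : ⨁ d, reesGrading I d) (i : ℕ) :
    ((DirectSum.coeAddMonoidHom (reesGrading I) x : reesAlgebra I) : Polynomial R).coeff i =
      ((x i : reesAlgebra I) : Polynomial R).coeff i := by
  classical
  induction x using DirectSum.induction_on with
  | zero => simp
  | of d y =>
    rw [DirectSum.coeAddMonoidHom_of]
    by_cases h : d = i
    · subst h
      rw [DirectSum.of_eq_same]
    · rw [DirectSum.of_eq_of_ne _ _ _ (Ne.symm h), y.2 i (Ne.symm h)]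
      simp
  | add x y hx hy => simp [hx, hy]

instance reesGrading_gradedAlgebra : GradedAlgebra (reesGrading I) where
  decompose' f := by
    classical
    exact DirectSum.mk (fun d => reesGrading I d) (f : Polynomial R).support
      fun d => reesComponent I f d
  left_inv f := by
    classical
    apply Subtype.ext
    ext i
    rw [rees_coeff_sum]
    by_cases h : i ∈ (f : Polynomial R).support
    · rw [DirectSum.mk_apply_of_mem h]
      simp [reesComponent]
    · rw [DirectSum.mk_apply_of_notMem h, Polynomial.notMem_support_iff.mp h]
      simp
  right_inv x := by
    classical
    refine DFinsupp.ext fun d => ?_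
    apply Subtype.ext
    apply Subtype.ext
    ext i
    have key := rees_coeff_sum I x
    by_cases hi : i = d
    · subst hi
      by_cases h : i ∈ ((DirectSum.coeAddMonoidHom (reesGrading I) x : reesAlgebra I) :
          Polynomial R).support
      · refine (congrArg (fun y : reesGrading I i => ((y : reesAlgebra I) : Polynomial R).coeff i)
          (DirectSum.mk_apply_of_mem (β := fun d => reesGrading I d) h)).trans ?_
        simp [reesComponent, key]
      · refine (congrArg (fun y : reesGrading I i => ((y : reesAlgebra I) : Polynomial R).coeff i)
          (DirectSum.mk_apply_of_notMem (β := fun d => reesGrading I d) h)).trans ?_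
        rw [← key i, Polynomial.notMem_support_iff.mp h]
        simp
    · rw [Subtype.prop (_ : reesGrading I d) i hi, (x d).2 i hi]

/-- The blowup of `Spec R` in the ideal `I`, as `Proj` of the Rees algebra of `I`. -/
def blowup : Scheme.{u} := Proj (reesGrading I)

/-- The blowup map `Bl_I (Spec R) ⟶ Spec R`. -/
def blowupMap : blowup I ⟶ Spec (CommRingCat.of R) :=
  Proj.toSpecZero (reesGrading I) ≫
    Spec.map (CommRingCat.ofHom (algebraMap R (reesGrading I 0)))

/-- The affine chart `D₊(g t)` of the blowup belonging to an element `g` of `I`. Its coordinate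
ring, the degree zero part of the Rees algebra localized at `g t`, is `R[g' / g : g' ∈ I]`
(if `R` is a domain and `g ≠ 0`). -/
def blowupChart (g : I) : (blowup I).Opens :=
  Proj.basicOpen (reesGrading I)
    ⟨Polynomial.monomial 1 (g : R), reesAlgebra.monomial_mem.mpr (by simp)⟩

end Blowup

/-! ### Monomial ideals and their Newton polyhedra -/

section Monomial

variable {n : ℕ}

/-- The monomial ideal `(x^a : a ∈ A)` of `K[x₁, …, xₙ]`. -/
def monomialIdeal (K : Type u) [Field K] (A : Set (Fin n →₀ ℕ)) :
    Ideal (MvPolynomial (Fin n) K) :=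
  Ideal.span ((fun a => MvPolynomial.monomial a (1 : K)) '' A)

/-- The support of an ideal: the exponents of all monomials in it. -/
def idealSupport {K : Type u} [Field K] (I : Ideal (MvPolynomial (Fin n) K)) :
    Set (Fin n →₀ ℕ) :=
  {a | MvPolynomial.monomial a (1 : K) ∈ I}

theorem subset_idealSupport (K : Type u) [Field K] {A : Set (Fin n →₀ ℕ)}
    {a : Fin n →₀ ℕ} (ha : a ∈ A) : a ∈ idealSupport (monomialIdeal K A) :=
  Ideal.subset_span ⟨a, ha, rfl⟩

/-- An exponent vector as a lattice point of `ℤⁿ`. -/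
def toLattice (a : Fin n →₀ ℕ) : Fin n → ℤ := fun i => (a i : ℤ)

/-- A lattice point of `ℤⁿ` as a point of `ℝⁿ`. -/
def latticeToReal (v : Fin n → ℤ) : Fin n → ℝ := fun i => (v i : ℝ)

/-- The Newton polyhedron `N(I) = conv(supp I) ⊆ ℝⁿ`. -/
def newtonPolyhedron {K : Type u} [Field K] (I : Ideal (MvPolynomial (Fin n) K)) :
    Set (Fin n → ℝ) :=
  convexHull ℝ ((fun a => latticeToReal (toLattice a)) '' idealSupport I)

/-- `a` is a vertex of the Newton polyhedron of `I`. -/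
def IsNewtonVertex {K : Type u} [Field K] (I : Ideal (MvPolynomial (Fin n) K))
    (a : Fin n →₀ ℕ) : Prop :=
  latticeToReal (toLattice a) ∈ (newtonPolyhedron I).extremePoints ℝ

/-- The real tangent cone `T_a(N)`: the cone generated by the vectors `p - a` with `p ∈ N`. -/
def realTangentCone (N : Set (Fin n → ℝ)) (a : Fin n → ℝ) : PointedCone ℝ (Fin n → ℝ) :=
  PointedCone.hull ℝ ((fun p => p - a) '' N)

/-- The ideal tangent cone `IT_a(I)` of the monomial `x^a`, where `I = (x^a' : a' ∈ A)`: the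
`ℕ`-span of all `a' - a` with `a ≠ a' ∈ A` and of the standard basis vectors. -/
def idealTangentCone (A : Set (Fin n →₀ ℕ)) (a : Fin n →₀ ℕ) : AddSubmonoid (Fin n → ℤ) :=
  AddSubmonoid.closure ((fun a' => toLattice a' - toLattice a) '' (A \ {a})) ⊔
    AddSubmonoid.closure (Set.range fun i : Fin n => (Pi.single i 1 : Fin n → ℤ))

/-- `M ∩ (-M) = {0}`. -/
def IsPointedMonoid (M : AddSubmonoid (Fin n → ℤ)) : Prop :=
  ∀ v, v ∈ M → -v ∈ M → v = 0

/-- `S` is a minimal set of generators of `M`: it generates `M`, and no element of `S` is an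
`ℕ`-linear combination of the other elements. -/
def IsMinimalGeneratingSet (S : Finset (Fin n → ℤ)) (M : AddSubmonoid (Fin n → ℤ)) : Prop :=
  AddSubmonoid.closure (S : Set (Fin n → ℤ)) = M ∧
    ∀ v ∈ S, v ∉ AddSubmonoid.closure ((S : Set (Fin n → ℤ)) \ {v})

/-- A pointed submonoid of `ℤⁿ` is simplicial if its minimal system of generators (unique by
pointedness) consists of exactly `n` vectors. -/
def IsSimplicial (M : AddSubmonoid (Fin n → ℤ)) : Prop :=
  IsPointedMonoid M ∧ ∃ S : Finset (Fin n → ℤ), IsMinimalGeneratingSet S M ∧ S.card = n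

/-- An integer vector is primitive if its coordinates are relatively prime. -/
def IsPrimitiveVector (v : Fin n → ℤ) : Prop := Finset.univ.gcd v = 1

/-- All lattice points neighboring `a`, that is, the points `a ± eᵢ` of `ℤⁿ`, lie in the set `S`
of exponents. -/
def NeighborsMem (S : Set (Fin n →₀ ℕ)) (a : Fin n →₀ ℕ) : Prop :=
  ∀ i : Fin n, toLattice a + Pi.single i 1 ∈ toLattice '' S ∧
    toLattice a - Pi.single i 1 ∈ toLattice '' S

variable (K : Type u) [Field K]

/-- The `a`-chart of the blowup of `𝔸ⁿ` in the monomial ideal `I = (x^a : a ∈ A)`, as an open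
subscheme, for a monomial `x^a` in `I`. -/
def monomialChart (A : Set (Fin n →₀ ℕ)) (a : Fin n →₀ ℕ)
    (ha : a ∈ idealSupport (monomialIdeal K A)) : (blowup (monomialIdeal K A)).Opens :=
  blowupChart (monomialIdeal K A) ⟨MvPolynomial.monomial a (1 : K), ha⟩

/-- The structure morphism of the `a`-chart over the base field. -/
def monomialChartStructure (A : Set (Fin n →₀ ℕ)) (a : Fin n →₀ ℕ)
    (ha : a ∈ idealSupport (monomialIdeal K A)) :
    (monomialChart K A a ha).toScheme ⟶ Spec (CommRingCat.of K) :=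
  (monomialChart K A a ha).ι ≫ blowupMap (monomialIdeal K A) ≫
    Spec.map (CommRingCat.ofHom (algebraMap K (MvPolynomial (Fin n) K)))

/-- The torus `(K^*)ⁿ`, as the spectrum of the ring `K[ℤⁿ]` of Laurent polynomials. -/
def algebraicTorus (n : ℕ) : Scheme.{u} :=
  Spec (CommRingCat.of (AddMonoidAlgebra K (Fin n → ℤ)))

/-- The structure morphism of the torus over the base field. -/
def algebraicTorusStructure (n : ℕ) : algebraicTorus K n ⟶ Spec (CommRingCat.of K) :=
  Spec.map (CommRingCat.ofHom (algebraMap K (AddMonoidAlgebra K (Fin n → ℤ))))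

end Monomial

end

/-! Everything rests on one identification: the coordinate ring of the `a`-chart is the monoid ring
`K[M]` with `M = IT_a(I)`. Setting `t = x^(-a)` embeds the degree-zero part of the Rees algebra
localized at `x^a t` into the Laurent polynomials, with image spanned by the monomials `x^m`, `m ∈
M` (`chartRingToLaurent_injective`, `range_chartRingToLaurent`, `exists_monomialChart_iso`). Part
(iv) follows at once, since there `M = ℤⁿ`.

For (i), fix a point `x` of the blowup and let `B` be the set of support points whose chart contains
`x`. A relation `∑ kₛ s = (∑ kₛ) b` becomes `∏ (x^s t)^kₛ = (x^b t)^(∑ kₛ)` in the Rees algebra. As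
`x` is a prime, `b ∈ B` forces every `s` with `kₛ > 0` into `B`. The lexicographic minimum of `B` is
then a vertex, because a non-vertex admits such a relation with all `s ≠ b`
(`exists_relation_of_not_isNewtonVertex`, `exists_isNewtonVertex_mem`).

For (ii), a vertex makes `M` pointed, and Dickson's lemma makes it finitely generated. If `M` has
exactly `n` minimal generators, they form a basis of `ℤⁿ`, because `M` contains all `eᵢ`; hence
`K[M]` is a polynomial ring. Conversely, formal smoothness lifts the tangent vector with
indeterminate coordinates `X_s` at the origin to arcs `x^s ↦ T(X_s + T q_s)` modulo any power of
`T`. Comparing lowest terms of a relation between generators gives the same monomial on both sides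
(`eq_of_sum_eq_of_formallySmooth`), so the generators are independent and there are `n` of them.

For (iii), `M` is the nonnegative orthant of a lattice basis. Basis vectors are primitive, and the
coordinate functionals, extended to `ℝⁿ`, are nonnegative on the real tangent cone. -/

/-! ### Lattice points and integral relations -/

section Lattice

variable {n : ℕ}

theorem latticeToReal_add (v w : Fin n → ℤ) :
    latticeToReal (v + w) = latticeToReal v + latticeToReal w := by
  ext i; simp [latticeToReal]

theorem latticeToReal_sub (v w : Fin n → ℤ) :
    latticeToReal (v - w) = latticeToReal v - latticeToReal w := by
  ext i; simp [latticeToReal]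

theorem latticeToReal_neg (v : Fin n → ℤ) : latticeToReal (-v) = -latticeToReal v := by
  ext i; simp [latticeToReal]

theorem latticeToReal_zero : latticeToReal (0 : Fin n → ℤ) = 0 := by
  ext i; simp [latticeToReal]

theorem latticeToReal_injective : Function.Injective (latticeToReal : (Fin n → ℤ) → _) := by
  intro v w h
  ext i
  have := congrFun h i
  simpa [latticeToReal] using this

theorem toLattice_injective : Function.Injective (toLattice : (Fin n →₀ ℕ) → _) := by
  intro v w h
  ext i
  have := congrFun h i
  simpa [toLattice] using this

theorem toLattice_zero : toLattice (0 : Fin n →₀ ℕ) = 0 := by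
  ext i; simp [toLattice]

theorem toLattice_add (a b : Fin n →₀ ℕ) : toLattice (a + b) = toLattice a + toLattice b := by
  ext i; simp [toLattice]

theorem toLattice_single (i : Fin n) :
    toLattice (Finsupp.single i 1) = (Pi.single i 1 : Fin n → ℤ) := by
  classical
  ext j
  simp [toLattice, Finsupp.single_apply, Pi.single_apply, eq_comm]

/-- A homogeneous linear system over `ℤ` with a positive real solution has a positive integral
solution. -/
theorem exists_pos_nat_relation {ι : Type*} [Fintype ι] (c : ι → Fin n → ℤ) (r : ι → ℝ)
    (hr : ∀ i, 0 < r i) (h : ∑ i, r i • latticeToReal (c i) = 0) :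
    ∃ k : ι → ℕ, (∀ i, 0 < k i) ∧ ∑ i, k i • c i = 0 := by
  classical
  obtain ⟨q, hq, hqc⟩ : ∃ q : ι → ℚ, (∀ i, 0 < q i) ∧ ∀ l, ∑ i, q i * (c i l : ℚ) = 0 := by
    -- Expand the `r i` in a `ℚ`-basis `b` of their span. As the `c i` are integral, the relation
    -- holds for each column of the coefficient matrix `p` separately.
    set W := Submodule.span ℚ (Set.range r) with hW
    have : FiniteDimensional ℚ W := FiniteDimensional.span_of_finite ℚ (Set.finite_range r)
    let b := Module.finBasis ℚ W
    let p : ι → Fin (Module.finrank ℚ W) → ℚ := fun i =>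
      b.repr ⟨r i, Submodule.subset_span ⟨i, rfl⟩⟩
    have hp (i) : ∑ j, (p i j : ℝ) * (b j : ℝ) = r i := by
      have := congrArg (Subtype.val) (b.sum_repr ⟨r i, Submodule.subset_span ⟨i, rfl⟩⟩)
      simp only [AddSubmonoidClass.coe_finsetSum, Submodule.coe_smul, Rat.smul_def] at this
      exact this
    have hrel (l) (j) : ∑ i, p i j * (c i l : ℚ) = 0 := by
      have h1 : ∑ i, r i * (c i l : ℝ) = 0 := by
        simpa [latticeToReal] using congrFun h l
      have h2 : ∑ j, (∑ i, p i j * (c i l : ℚ)) • b j = 0 := by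
        apply Subtype.ext
        simp only [AddSubmonoidClass.coe_finsetSum, Submodule.coe_smul, Rat.smul_def,
          ZeroMemClass.coe_zero]
        rw [← h1]
        simp_rw [← hp]
        push_cast
        simp_rw [Finset.sum_mul]
        rw [Finset.sum_comm]
        refine Finset.sum_congr rfl fun i _ => Finset.sum_congr rfl fun j _ => by ring
      exact Fintype.linearIndependent_iff.mp b.linearIndependent _ h2 j
    -- The relation survives replacing `b` by any vector `w`, and positivity is an open condition
    -- satisfied at `b`; so a rational `w` near `b` works.
    let U : Set (Fin (Module.finrank ℚ W) → ℝ) := {w | ∀ i, 0 < ∑ j, (p i j : ℝ) * w j}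
    have hU : IsOpen U := by
      simp only [U, Set.ofPred_forall]
      exact isOpen_iInter_of_finite fun i => isOpen_lt continuous_const (by fun_prop)
    have hd : DenseRange (Pi.map fun (_ : Fin (Module.finrank ℚ W)) (x : ℚ) => (x : ℝ)) :=
      DenseRange.piMap fun _ => Rat.denseRange_cast
    obtain ⟨w, hw⟩ := hd.exists_mem_open hU ⟨fun j => (b j : ℝ), fun i => by rw [hp]; exact hr i⟩
    refine ⟨fun i => ∑ j, p i j * w j, fun i => ?_, fun l => ?_⟩
    · have := hw i
      simp only [Pi.map_apply] at this
      exact_mod_cast this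
    · simp_rw [Finset.sum_mul]
      rw [Finset.sum_comm]
      refine Finset.sum_eq_zero fun j _ => ?_
      rw [← zero_mul (w j), ← hrel l j, Finset.sum_mul]
      exact Finset.sum_congr rfl fun i _ => by ring
  have key (i) : ∃ k : ℕ, 0 < k ∧ (k : ℚ) = (∏ i, (q i).den : ℕ) * q i := by
    obtain ⟨m, hm⟩ := Finset.dvd_prod_of_mem (fun i => (q i).den) (Finset.mem_univ i)
    have hpos : 0 < ∏ i, (q i).den := Finset.prod_pos fun i _ => (q i).den_pos
    have hm0 : 0 < m := Nat.pos_of_ne_zero fun h0 => by simp [hm, h0] at hpos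
    have hnum : 0 < (q i).num := Rat.num_pos.mpr (hq i)
    refine ⟨m * (q i).num.toNat, Nat.mul_pos hm0 (by omega), ?_⟩
    have h3 : (((q i).num.toNat : ℕ) : ℚ) = (q i).num := by
      exact_mod_cast congrArg (Int.cast (R := ℚ)) (Int.toNat_of_nonneg hnum.le)
    rw [hm]
    push_cast
    rw [h3]
    have := Rat.mul_den_eq_num (q i)
    rw [← this]
    ring
  choose k hk hkq using key
  refine ⟨k, hk, ?_⟩
  ext l
  have : ∑ i, (k i : ℚ) * (c i l : ℚ) = 0 := by
    simp_rw [hkq, mul_assoc]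
    rw [← Finset.mul_sum, hqc, mul_zero]
  simp only [Finset.sum_apply, nsmul_eq_mul, Pi.zero_apply]
  exact_mod_cast this

end Lattice

/-! ### Support, vertices and directions into the Newton polyhedron -/

section Support

variable {n : ℕ} {K : Type u} [Field K] {A : Set (Fin n →₀ ℕ)} {a : Fin n →₀ ℕ}

theorem mem_idealSupport_iff :
    a ∈ idealSupport (monomialIdeal K A) ↔ ∃ b ∈ A, b ≤ a := by
  classical
  rw [idealSupport, monomialIdeal, Set.mem_ofPred_eq, MvPolynomial.mem_ideal_span_monomial_image]
  simp [MvPolynomial.support_monomial]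

theorem add_mem_idealSupport (ha : a ∈ idealSupport (monomialIdeal K A)) (c : Fin n →₀ ℕ) :
    a + c ∈ idealSupport (monomialIdeal K A) := by
  rw [mem_idealSupport_iff] at ha ⊢
  obtain ⟨b, hb, hba⟩ := ha
  exact ⟨b, hb, hba.trans (le_add_right le_rfl)⟩

theorem mem_newtonPolyhedron {I : Ideal (MvPolynomial (Fin n) K)} (ha : a ∈ idealSupport I) :
    latticeToReal (toLattice a) ∈ newtonPolyhedron I :=
  subset_convexHull ℝ _ ⟨a, ha, rfl⟩

/-- If `a = b + c` with `b ∈ A`, then `a` is the midpoint of `b` and `a + c`, both in the support;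
extremality forces `b = a`. -/
theorem mem_of_isNewtonVertex (ha : a ∈ idealSupport (monomialIdeal K A))
    (hv : IsNewtonVertex (monomialIdeal K A) a) : a ∈ A := by
  obtain ⟨b, hb, hba⟩ := mem_idealSupport_iff.mp ha
  obtain ⟨c, rfl⟩ := exists_add_of_le hba
  have h := mem_extremePoints.mp hv
  have h1 := (h.2 _ (mem_newtonPolyhedron (subset_idealSupport K hb)) _
    (mem_newtonPolyhedron (add_mem_idealSupport ha c)) ?_).1
  · have := toLattice_injective (latticeToReal_injective h1)
    rwa [← this]
  · refine ⟨1 / 2, 1 / 2, by norm_num, by norm_num, by norm_num, ?_⟩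
    simp only [toLattice_add, latticeToReal_add]
    module

theorem toLattice_mem_idealTangentCone (A : Set (Fin n →₀ ℕ)) (a c : Fin n →₀ ℕ) :
    toLattice c ∈ idealTangentCone A a := by
  classical
  refine AddSubmonoid.mem_sup_right ?_
  induction c using Finsupp.induction_linear with
  | zero => rw [toLattice_zero]; exact zero_mem _
  | add f g hf hg => rw [toLattice_add]; exact add_mem hf hg
  | single i k =>
    have : toLattice (Finsupp.single i k) = k • (Pi.single i 1 : Fin n → ℤ) := by
      rw [← toLattice_single]
      ext j
      simp [toLattice, Finsupp.single_apply]
    rw [this]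
    exact nsmul_mem (AddSubmonoid.subset_closure (Set.mem_range_self i)) k

theorem sub_mem_idealTangentCone {b : Fin n →₀ ℕ} (hb : b ∈ A) (a : Fin n →₀ ℕ) :
    toLattice b - toLattice a ∈ idealTangentCone A a := by
  by_cases h : b = a
  · rw [h, sub_self]; exact zero_mem _
  · exact AddSubmonoid.mem_sup_left (AddSubmonoid.subset_closure ⟨b, ⟨hb, h⟩, rfl⟩)

theorem sub_mem_idealTangentCone_of_mem_idealSupport {b : Fin n →₀ ℕ}
    (hb : b ∈ idealSupport (monomialIdeal K A)) (a : Fin n →₀ ℕ) :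
    toLattice b - toLattice a ∈ idealTangentCone A a := by
  obtain ⟨b', hb', hle⟩ := mem_idealSupport_iff.mp hb
  obtain ⟨c, rfl⟩ := exists_add_of_le hle
  rw [toLattice_add, add_sub_right_comm]
  exact add_mem (sub_mem_idealTangentCone hb' a) (toLattice_mem_idealTangentCone A a c)

theorem idealTangentCone_eq_closure (A : Set (Fin n →₀ ℕ)) (a : Fin n →₀ ℕ) :
    idealTangentCone A a = AddSubmonoid.closure
      ((fun b => toLattice b - toLattice a) '' (A \ {a}) ∪
        Set.range fun i : Fin n => (Pi.single i 1 : Fin n → ℤ)) :=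
  (AddSubmonoid.closure_union _ _).symm

/-- Generators of the cone are reached with step 1, and convexity makes the admissible directions
closed under addition. Only some positive step survives, which suffices for pointedness and for the
comparison with the real tangent cone. -/
theorem exists_pos_smul_mem_newtonPolyhedron (ha : a ∈ idealSupport (monomialIdeal K A))
    {v : Fin n → ℤ} (hv : v ∈ idealTangentCone A a) :
    ∃ ε : ℝ, 0 < ε ∧ latticeToReal (toLattice a) + ε • latticeToReal v ∈
      newtonPolyhedron (monomialIdeal K A) := by
  rw [idealTangentCone_eq_closure] at hv
  induction hv using AddSubmonoid.closure_induction with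
  | mem v hv =>
    refine ⟨1, one_pos, ?_⟩
    rw [one_smul, ← latticeToReal_add]
    rcases hv with ⟨b, hb, rfl⟩ | ⟨i, rfl⟩
    · simpa using mem_newtonPolyhedron (subset_idealSupport K hb.1)
    · simp only [← toLattice_single, ← toLattice_add]
      exact mem_newtonPolyhedron (add_mem_idealSupport ha _)
  | zero =>
    refine ⟨1, one_pos, ?_⟩
    simpa [latticeToReal_zero] using mem_newtonPolyhedron ha
  | add v w _ _ hv hw =>
    obtain ⟨ε, hε, hv⟩ := hv
    obtain ⟨δ, hδ, hw⟩ := hw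
    have hne : ε + δ ≠ 0 := by positivity
    -- The weights `δ/(ε+δ)` and `ε/(ε+δ)` give `εv` and `δw` the same coefficient.
    refine ⟨ε * δ / (ε + δ), by positivity, ?_⟩
    have := convex_convexHull ℝ _ hv hw (a := δ / (ε + δ)) (b := ε / (ε + δ)) (by positivity)
      (by positivity) (by field_simp; ring)
    rw [newtonPolyhedron]
    convert this using 1
    rw [latticeToReal_add]
    ext i
    simp only [Pi.add_apply, Pi.smul_apply, smul_eq_mul]
    field_simp
    ring

/-- If both `v` and `-v` lie in the cone, then `a` lies between `a + εv` and `a - δv` in the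
polyhedron, so extremality gives `v = 0`. -/
theorem isPointedMonoid_of_isNewtonVertex (ha : a ∈ idealSupport (monomialIdeal K A))
    (hv : IsNewtonVertex (monomialIdeal K A) a) : IsPointedMonoid (idealTangentCone A a) := by
  intro v h1 h2
  obtain ⟨ε, hε, h1⟩ := exists_pos_smul_mem_newtonPolyhedron ha h1
  obtain ⟨δ, hδ, h2⟩ := exists_pos_smul_mem_newtonPolyhedron ha h2
  have h := ((mem_extremePoints.mp hv).2 _ h1 _ h2 ?_).1
  · have h0 : latticeToReal v = 0 := by
      simpa [hε.ne'] using h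
    exact latticeToReal_injective (h0.trans latticeToReal_zero.symm)
  · have hne : ε + δ ≠ 0 := by positivity
    refine ⟨δ / (ε + δ), ε / (ε + δ), by positivity, by positivity, by field_simp; ring, ?_⟩
    rw [latticeToReal_neg]
    ext i
    simp only [Pi.add_apply, Pi.smul_apply, smul_eq_mul, Pi.neg_apply]
    field_simp
    ring

open scoped NNReal in
/-- A support point that is not a vertex is a weighted mean of other support points, with
integral weights. -/
theorem exists_relation_of_not_isNewtonVertex {I : Ideal (MvPolynomial (Fin n) K)}
    (ha : a ∈ idealSupport I) (hv : ¬ IsNewtonVertex I a) :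
    ∃ (t : Finset (Fin n →₀ ℕ)) (k : (Fin n →₀ ℕ) → ℕ), t.Nonempty ∧ (∀ s ∈ t, 0 < k s) ∧
      (∀ s ∈ t, s ∈ idealSupport I ∧ s ≠ a) ∧ ∑ s ∈ t, k s • s = (∑ s ∈ t, k s) • a := by
  classical
  let d : (Fin n →₀ ℕ) → (Fin n → ℝ) := fun s =>
    latticeToReal (toLattice s) - latticeToReal (toLattice a)
  let C : PointedCone ℝ (Fin n → ℝ) := PointedCone.hull ℝ (d '' (idealSupport I \ {a}))
  have hC (p) (hp : p ∈ newtonPolyhedron I) : p - latticeToReal (toLattice a) ∈ C := by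
    have hconv : Convex ℝ {p | p - latticeToReal (toLattice a) ∈ C} := by
      intro x hx y hy s t hs ht hst
      have := C.add_mem (C.smul_mem hs hx) (C.smul_mem ht hy)
      have h1 : s • x + t • y - latticeToReal (toLattice a) =
          s • (x - latticeToReal (toLattice a)) + t • (y - latticeToReal (toLattice a)) := by
        rw [smul_sub, smul_sub, sub_add_sub_comm, ← add_smul, hst, one_smul]
      exact (congrArg (· ∈ C) h1).mpr this
    refine convexHull_min ?_ hconv hp
    rintro _ ⟨s, hs, rfl⟩
    by_cases h : s = a
    · simp [h]
    · exact Submodule.subset_span ⟨s, ⟨hs, h⟩, rfl⟩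
  -- A non-vertex is `s p + t q` with `p`, `q` not both equal to `a`, so `s (p - a) = -t (q - a)`
  -- spans a line inside `C`.
  have hne : ∃ u, u ≠ 0 ∧ u ∈ C ∧ -u ∈ C := by
    have h := mt mem_extremePoints.mpr hv
    push Not at h
    obtain ⟨p, hp, q, hq, hpq, hpa⟩ := h (mem_newtonPolyhedron ha)
    obtain ⟨s, t, hs, ht, hst, hpq⟩ := hpq
    have h1 : s • (p - latticeToReal (toLattice a)) = - (t • (q - latticeToReal (toLattice a))) := by
      rw [eq_neg_iff_add_eq_zero, smul_sub, smul_sub, sub_add_sub_comm, ← add_smul, hst, one_smul,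
        hpq, sub_self]
    refine ⟨s • (p - latticeToReal (toLattice a)), ?_, C.smul_mem hs.le (hC p hp), ?_⟩
    · intro h0
      have hp0 : p = latticeToReal (toLattice a) := by
        simpa [hs.ne', sub_eq_zero] using h0
      have hq0 : q = latticeToReal (toLattice a) := by
        rw [h0] at h1
        simpa [ht.ne', sub_eq_zero] using h1.symm
      exact hpa hp0 hq0
    · rw [h1, neg_neg]
      exact C.smul_mem ht.le (hC q hq)
  obtain ⟨u, hu0, hu, hu'⟩ := hne
  obtain ⟨f, hf, hfu⟩ := (Finsupp.mem_span_image_iff_linearCombination _).mp hu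
  obtain ⟨g, hg, hgu⟩ := (Finsupp.mem_span_image_iff_linearCombination _).mp hu'
  -- Adding the expansions of `u` and `-u` gives a relation; it is nontrivial because nonnegative
  -- coefficients cannot cancel.
  set F := f + g with hF
  have hFsum : Finsupp.linearCombination {c : ℝ // 0 ≤ c} d F = 0 := by
    rw [hF, map_add, hfu, hgu, add_neg_cancel]
  have hFsupp : ∀ s ∈ F.support, s ∈ idealSupport I ∧ s ≠ a := by
    intro s hs
    rcases Finset.mem_union.mp (Finsupp.support_add hs) with h | h
    · exact hf h
    · exact hg h
  have hFne : F.support.Nonempty := by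
    rw [Finsupp.support_nonempty_iff]
    intro h0
    apply hu0
    have : f = 0 := by
      ext s
      have := congrArg (fun x : {c : ℝ // 0 ≤ c} => (x : ℝ)) (DFunLike.congr_fun h0 s)
      have h1 := (f s).2
      have h2 := (g s).2
      simp only [hF, Finsupp.coe_add, Pi.add_apply, Nonneg.coe_add, Finsupp.coe_zero,
        Pi.zero_apply, Nonneg.coe_zero] at this ⊢
      linarith
    rw [← hfu, this, map_zero]
  obtain ⟨k, hk, hksum⟩ := exists_pos_nat_relation
    (fun s : F.support => toLattice s.1 - toLattice a) (fun s => (F s.1 : ℝ))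
    (fun s => lt_of_le_of_ne (F s.1).2 fun h => Finsupp.mem_support_iff.mp s.2 (Subtype.ext h.symm))
    (by
      rw [Finsupp.linearCombination_apply, Finsupp.sum, ← Finset.sum_coe_sort] at hFsum
      rw [← hFsum]
      refine Finset.sum_congr rfl fun s _ => ?_
      rw [latticeToReal_sub]
      rfl)
  refine ⟨F.support, fun s => if h : s ∈ F.support then k ⟨s, h⟩ else 0, hFne, ?_, hFsupp, ?_⟩
  · intro s hs
    simp only [hs, dif_pos]
    exact hk _
  · rw [← Finset.sum_coe_sort, ← Finset.sum_coe_sort F.support]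
    simp only [Finset.coe_mem, dif_pos]
    ext i
    have := congrFun hksum i
    simp only [Finset.sum_apply, nsmul_eq_mul, Pi.zero_apply, Pi.mul_apply, Pi.sub_apply,
      Pi.natCast_apply, mul_sub, Finset.sum_sub_distrib, sub_eq_zero, toLattice] at this
    simp only [Finsupp.coe_finsetSum, Finset.sum_apply, Finsupp.smul_apply, smul_eq_mul,
      Finset.sum_mul]
    exact_mod_cast this

/-- The lexicographically minimal element of a set of support points that is closed under
passing from a weighted mean to its constituents is a vertex. -/
theorem exists_isNewtonVertex_mem {I : Ideal (MvPolynomial (Fin n) K)} {B : Set (Fin n →₀ ℕ)}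
    (hB : B.Nonempty) (hBI : B ⊆ idealSupport I)
    (hface : ∀ b ∈ B, ∀ (t : Finset (Fin n →₀ ℕ)) (k : (Fin n →₀ ℕ) → ℕ), (∀ s ∈ t, 0 < k s) →
      (∀ s ∈ t, s ∈ idealSupport I) → ∑ s ∈ t, k s • s = (∑ s ∈ t, k s) • b → ∀ s ∈ t, s ∈ B) :
    ∃ b ∈ B, IsNewtonVertex I b := by
  -- What is used is a well-order compatible with addition: a weighted mean of elements strictly
  -- above `b` cannot equal `b`.
  let m : MonomialOrder (Fin n) := MonomialOrder.lex
  obtain ⟨b, hb, hmin⟩ := WellFounded.has_min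
    (InvImage.wf m.toSyn (wellFounded_lt (α := m.syn))) B hB
  refine ⟨b, hb, ?_⟩
  by_contra hv
  obtain ⟨t, k, htne, hk, ht, hsum⟩ := exists_relation_of_not_isNewtonVertex (hBI hb) hv
  have htB := hface b hb t k hk (fun s hs => (ht s hs).1) hsum
  have hlt : ∑ s ∈ t, k s • m.toSyn b < ∑ s ∈ t, k s • m.toSyn s := by
    refine Finset.sum_lt_sum_of_nonempty htne fun s hs => ?_
    have hle : m.toSyn b < m.toSyn s := by
      refine lt_of_le_of_ne (not_lt.mp (hmin s (htB s hs))) fun h => (ht s hs).2 ?_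
      exact (m.toSyn.injective h).symm
    exact nsmul_lt_nsmul_right (hk s hs).ne' hle
  refine hlt.ne ?_
  rw [← Finset.sum_smul, ← map_nsmul, ← hsum, map_sum]
  simp only [map_nsmul]

end Support

/-! ### Minimal generators of submonoids of the lattice -/

section MinimalGenerators

variable {n : ℕ} {M : AddSubmonoid (Fin n → ℤ)} {S : Finset (Fin n → ℤ)}

namespace IsMinimalGeneratingSet

theorem mem (hS : IsMinimalGeneratingSet S M) {v : Fin n → ℤ} (hv : v ∈ S) : v ∈ M :=
  hS.1 ▸ AddSubmonoid.subset_closure hv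

theorem ne_zero (hS : IsMinimalGeneratingSet S M) {v : Fin n → ℤ} (hv : v ∈ S) : v ≠ 0 := by
  rintro rfl
  exact hS.2 0 hv (zero_mem _)

/-- Minimal generators are irreducible. An element of `M` either avoids `v` in some expression or
has the form `v + u` with `u ∈ M`. If both summands avoid `v`, minimality fails; otherwise the
remaining terms add to zero and pointedness applies. -/
theorem eq_zero_or_eq_zero (hS : IsMinimalGeneratingSet S M) (hM : IsPointedMonoid M)
    {v x y : Fin n → ℤ} (hv : v ∈ S) (hx : x ∈ M) (hy : y ∈ M) (h : x + y = v) :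
    x = 0 ∨ y = 0 := by
  have key (w) (hw : w ∈ M) : w ∈ AddSubmonoid.closure ((S : Set (Fin n → ℤ)) \ {v}) ∨
      ∃ u ∈ M, w = v + u := by
    rw [← hS.1] at hw
    induction hw using AddSubmonoid.closure_induction with
    | mem w hw =>
      by_cases h : w = v
      · exact Or.inr ⟨0, zero_mem _, by simp [h]⟩
      · exact Or.inl (AddSubmonoid.subset_closure ⟨hw, h⟩)
    | zero => exact Or.inl (zero_mem _)
    | add w w' hwm hwm' hw hw' =>
      rw [hS.1] at hwm hwm'
      rcases hw with hw | ⟨u, hu, rfl⟩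
      · rcases hw' with hw' | ⟨u, hu, rfl⟩
        · exact Or.inl (add_mem hw hw')
        · exact Or.inr ⟨w + u, add_mem hwm hu, by abel⟩
      · exact Or.inr ⟨u + w', add_mem hu hwm', by abel⟩
  have aux {u z : Fin n → ℤ} (hu : u ∈ M) (hz : z ∈ M) (h : v + u + z = v) : z = 0 := by
    have h0 : u + z = 0 := by
      rw [add_assoc] at h
      simpa using h
    exact hM z hz (by rwa [← eq_neg_of_add_eq_zero_left h0])
  rcases key x hx with hx' | ⟨u, hu, rfl⟩
  · rcases key y hy with hy' | ⟨u, hu, rfl⟩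
    · exact absurd ((congrArg (· ∈ AddSubmonoid.closure _) h).mp (add_mem hx' hy')) (hS.2 v hv)
    · exact Or.inl (aux hu hx (by rwa [add_comm] at h))
  · exact Or.inr (aux hu hy h)

/-- Irreducible elements must occur in every generating set; this yields uniqueness. -/
theorem subset (hS : IsMinimalGeneratingSet S M) (hM : IsPointedMonoid M)
    {T : Set (Fin n → ℤ)} (hT : AddSubmonoid.closure T = M) : (S : Set (Fin n → ℤ)) ⊆ T := by
  intro v hv
  have key (x) (hx : x ∈ M) : x = v → v ∈ T := by
    rw [← hT] at hx
    induction hx using AddSubmonoid.closure_induction with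
    | mem x hx => rintro rfl; exact hx
    | zero => intro h; exact absurd h.symm (hS.ne_zero hv)
    | add x y hxm hym hx hy =>
      rw [hT] at hxm hym
      intro h
      rcases hS.eq_zero_or_eq_zero hM hv hxm hym h with rfl | rfl
      · exact hy (by simpa using h)
      · exact hx (by simpa using h)
  exact key v (hS.mem hv) rfl

theorem unique (hS : IsMinimalGeneratingSet S M) (hM : IsPointedMonoid M)
    {T : Finset (Fin n → ℤ)} (hT : IsMinimalGeneratingSet T M) : S = T :=
  Finset.coe_injective ((hS.subset hM hT.1).antisymm (hT.subset hM hS.1))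

end IsMinimalGeneratingSet

theorem exists_isMinimalGeneratingSet (hM : M.FG) : ∃ S, IsMinimalGeneratingSet S M := by
  classical
  obtain ⟨T, hT⟩ := hM
  obtain ⟨S, -, hS⟩ := exists_minimal_le_of_wellFoundedLT
    (fun S : Finset (Fin n → ℤ) => AddSubmonoid.closure (S : Set (Fin n → ℤ)) = M) T hT
  refine ⟨S, hS.1, fun v hv hvS => ?_⟩
  have h : AddSubmonoid.closure ((S.erase v : Finset _) : Set (Fin n → ℤ)) = M := by
    rw [← hS.1, Finset.coe_erase]
    refine le_antisymm (AddSubmonoid.closure_mono Set.sdiff_subset) ?_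
    rw [AddSubmonoid.closure_le]
    intro w hw
    by_cases h : w = v
    · rw [h]; exact hvS
    · exact AddSubmonoid.subset_closure ⟨hw, h⟩
  exact Finset.notMem_erase v S (hS.2 h (Finset.erase_subset v S) hv)

theorem span_eq_top_of_closure_eq (hS : AddSubmonoid.closure (S : Set (Fin n → ℤ)) = M)
    (hM : ∀ i, Pi.single i 1 ∈ M) : Submodule.span ℤ (S : Set (Fin n → ℤ)) = ⊤ := by
  rw [eq_top_iff, ← (Pi.basisFun ℤ (Fin n)).span_eq, Submodule.span_le]
  rintro _ ⟨i, rfl⟩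
  have h : M ≤ (Submodule.span ℤ (S : Set (Fin n → ℤ))).toAddSubmonoid := by
    rw [← hS, AddSubmonoid.closure_le]
    exact Submodule.subset_span
  rw [Pi.basisFun_apply]
  exact h (hM i)

/-- A set of `n` vectors generating a monoid that contains the standard basis vectors is a basis
of the lattice. -/
noncomputable def latticeBasis (hS : AddSubmonoid.closure (S : Set (Fin n → ℤ)) = M)
    (hM : ∀ i, Pi.single i 1 ∈ M) (hcard : S.card = n) : Module.Basis S ℤ (Fin n → ℤ) :=
  Module.Basis.mk (v := fun s : S => (s : Fin n → ℤ))
    (linearIndependent_of_top_le_span_of_card_eq_finrank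
      (by
        rw [Subtype.range_coe_subtype, Finset.setOfPred_mem]
        exact (span_eq_top_of_closure_eq hS hM).ge) (by simp [hcard]))
    (by
      rw [Subtype.range_coe_subtype, Finset.setOfPred_mem]
      exact (span_eq_top_of_closure_eq hS hM).ge)

theorem latticeBasis_apply (hS : AddSubmonoid.closure (S : Set (Fin n → ℤ)) = M)
    (hM : ∀ i, Pi.single i 1 ∈ M) (hcard : S.card = n) (s : S) :
    latticeBasis hS hM hcard s = s := by
  simp [latticeBasis]

theorem latticeBasis_repr_coe (hS : AddSubmonoid.closure (S : Set (Fin n → ℤ)) = M)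
    (hM : ∀ i, Pi.single i 1 ∈ M) (hcard : S.card = n) (s : S) :
    (latticeBasis hS hM hcard).repr s = Finsupp.single s 1 := by
  rw [← Module.Basis.repr_self (latticeBasis hS hM hcard) s, latticeBasis_apply]

/-- In the basis `S`, the monoid is the standard orthant. In particular it is saturated, which is
what part (iii) needs. -/
theorem mem_iff_latticeBasis_repr_nonneg (hS : AddSubmonoid.closure (S : Set (Fin n → ℤ)) = M)
    (hM : ∀ i, Pi.single i 1 ∈ M) (hcard : S.card = n) (v : Fin n → ℤ) :
    v ∈ M ↔ ∀ s, 0 ≤ (latticeBasis hS hM hcard).repr v s := by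
  constructor
  · intro hv
    rw [← hS] at hv
    induction hv using AddSubmonoid.closure_induction with
    | mem v hv =>
      intro s
      classical
      rw [latticeBasis_repr_coe hS hM hcard ⟨v, hv⟩, Finsupp.single_apply]
      split_ifs <;> simp
    | zero => simp
    | add x y _ _ hx hy =>
      intro s
      rw [map_add, Finsupp.add_apply]
      exact add_nonneg (hx s) (hy s)
  · intro h
    rw [← (latticeBasis hS hM hcard).sum_repr v]
    refine sum_mem fun s _ => ?_
    rw [latticeBasis_apply]
    obtain ⟨k, hk⟩ := Int.eq_ofNat_of_zero_le (h s)
    rw [hk, natCast_zsmul]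
    exact nsmul_mem (hS ▸ AddSubmonoid.subset_closure s.2) k

theorem isPrimitiveVector_of_mem (hS : AddSubmonoid.closure (S : Set (Fin n → ℤ)) = M)
    (hM : ∀ i, Pi.single i 1 ∈ M) (hcard : S.card = n) {v : Fin n → ℤ} (hv : v ∈ S) :
    IsPrimitiveVector v := by
  rw [IsPrimitiveVector, ← Finset.normalize_gcd, normalize_eq_one]
  have h (i) : Finset.univ.gcd v ∣ v i := Finset.gcd_dvd (Finset.mem_univ i)
  choose w hw using h
  have h1 : v = Finset.univ.gcd v • w := funext hw
  -- The coordinate of `v` along itself is 1 and is divisible by the gcd.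
  have h2 := congrArg (fun x => (latticeBasis hS hM hcard).repr x ⟨v, hv⟩) h1
  simp only [map_smul, Finsupp.smul_apply, smul_eq_mul] at h2
  rw [latticeBasis_repr_coe hS hM hcard ⟨v, hv⟩, Finsupp.single_eq_same] at h2
  exact IsUnit.of_mul_eq_one _ h2.symm

/-- A simplicial monoid is freely generated by its minimal generators. -/
noncomputable def simplicialEquiv (hS : AddSubmonoid.closure (S : Set (Fin n → ℤ)) = M)
    (hM : ∀ i, Pi.single i 1 ∈ M) (hcard : S.card = n) : (S →₀ ℕ) ≃+ M :=
  AddEquiv.ofBijective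
    ((Finsupp.liftAddHom fun s : S =>
      (multiplesHom M ⟨(s : Fin n → ℤ), hS ▸ AddSubmonoid.subset_closure s.2⟩)) :
        (S →₀ ℕ) →+ M) <| by
    have hrepr (f : S →₀ ℕ) (s : S) : (latticeBasis hS hM hcard).repr
        ((Finsupp.liftAddHom fun s : S =>
          (multiplesHom M ⟨(s : Fin n → ℤ), hS ▸ AddSubmonoid.subset_closure s.2⟩)) f : M) s =
          f s := by
      induction f using Finsupp.induction_linear with
      | zero => simp
      | add f g hf hg => rw [map_add, AddSubmonoid.coe_add, map_add, Finsupp.add_apply, hf, hg]; simp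
      | single t k =>
        classical
        simp only [Finsupp.liftAddHom_apply_single, multiplesHom_apply, AddSubmonoidClass.coe_nsmul]
        rw [map_nsmul, latticeBasis_repr_coe]
        simp [Finsupp.single_apply]
    constructor
    · intro f g h
      ext s
      have := hrepr f s
      rw [h, hrepr] at this
      exact_mod_cast this.symm
    · intro v
      have hv := (mem_iff_latticeBasis_repr_nonneg hS hM hcard v).mp v.2
      refine ⟨Finsupp.equivFunOnFinite.symm fun s =>
        ((latticeBasis hS hM hcard).repr v s).toNat, Subtype.ext ?_⟩
      apply (latticeBasis hS hM hcard).repr.injective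
      ext s
      rw [hrepr]
      simp [hv s]

end MinimalGenerators

/-! ### Ideal and real tangent cones -/

section TangentCone

variable {n : ℕ} {A : Set (Fin n →₀ ℕ)} {a : Fin n →₀ ℕ}

theorem single_mem_idealTangentCone (A : Set (Fin n →₀ ℕ)) (a : Fin n →₀ ℕ) (i : Fin n) :
    Pi.single i 1 ∈ idealTangentCone A a := by
  rw [← toLattice_single]
  exact toLattice_mem_idealTangentCone A a _

theorem idealTangentCone_mono {B : Set (Fin n →₀ ℕ)} (h : B ⊆ A) :
    idealTangentCone B a ≤ idealTangentCone A a :=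
  sup_le_sup_right (AddSubmonoid.closure_mono (Set.image_mono (Set.sdiff_subset_sdiff_left h))) _

/-- By Dickson's lemma `A` has finitely many minimal elements, and the `eᵢ` supply the differences
to all others. -/
theorem idealTangentCone_fg (A : Set (Fin n →₀ ℕ)) (a : Fin n →₀ ℕ) :
    (idealTangentCone A a).FG := by
  let B : Set (Fin n →₀ ℕ) := {x | Minimal (· ∈ A) x}
  have hB : B.Finite :=
    (setOfPred_minimal_antichain (· ∈ A)).finite_of_partiallyWellOrderedOn
      (Set.isPWO_of_wellQuasiOrderedLE B)
  have h : idealTangentCone A a = idealTangentCone B a := by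
    refine le_antisymm (sup_le ?_ le_sup_right) (idealTangentCone_mono fun x hx => hx.1)
    rw [AddSubmonoid.closure_le]
    rintro _ ⟨c, ⟨hc, -⟩, rfl⟩
    obtain ⟨b, hbc, hb⟩ := exists_minimal_le_of_wellFoundedLT (· ∈ A) c hc
    obtain ⟨d, rfl⟩ := exists_add_of_le hbc
    simp only [toLattice_add, add_sub_right_comm]
    exact add_mem (sub_mem_idealTangentCone hb a) (toLattice_mem_idealTangentCone B a d)
  rw [h, idealTangentCone_eq_closure]
  exact (AddSubmonoid.fg_iff _).mpr ⟨_, rfl,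
    ((hB.subset Set.sdiff_subset).image _).union (Set.finite_range _)⟩

/-- The real functional extending an integral one. -/
noncomputable def realExtension (φ : (Fin n → ℤ) →ₗ[ℤ] ℤ) : (Fin n → ℝ) →ₗ[ℝ] ℝ :=
  ∑ i, (φ (Pi.single i 1) : ℝ) • LinearMap.proj i

theorem realExtension_latticeToReal (φ : (Fin n → ℤ) →ₗ[ℤ] ℤ) (v : Fin n → ℤ) :
    realExtension φ (latticeToReal v) = φ v := by
  conv_rhs => rw [← (Pi.basisFun ℤ (Fin n)).sum_repr v, map_sum]
  simp only [map_smul, realExtension, LinearMap.sum_apply, LinearMap.smul_apply,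
    LinearMap.proj_apply, latticeToReal, Pi.basisFun_apply, Pi.basisFun_repr, smul_eq_mul,
    Int.cast_sum, Int.cast_mul, mul_comm]

variable {K : Type u} [Field K]

theorem nonneg_of_mem_realTangentCone (φ : (Fin n → ℝ) →ₗ[ℝ] ℝ)
    (hφ : ∀ s ∈ idealSupport (monomialIdeal K A),
      0 ≤ φ (latticeToReal (toLattice s) - latticeToReal (toLattice a)))
    {x : Fin n → ℝ} (hx : x ∈ realTangentCone (newtonPolyhedron (monomialIdeal K A))
      (latticeToReal (toLattice a))) : 0 ≤ φ x := by
  induction hx using Submodule.span_induction with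
  | mem x hx =>
    obtain ⟨p, hp, rfl⟩ := hx
    have hconv : Convex ℝ {p | φ (latticeToReal (toLattice a)) ≤ φ p} :=
      convex_halfSpace_ge φ.isLinear _
    have := convexHull_min ?_ hconv hp
    · simpa using this
    · rintro _ ⟨s, hs, rfl⟩
      simpa using hφ s hs
  | zero => simp
  | add x y _ _ hx hy => rw [map_add]; exact add_nonneg hx hy
  | smul c x _ hx =>
    have : φ (c • x) = (c : ℝ) * φ x := φ.map_smul (c : ℝ) x
    rw [this]
    exact mul_nonneg c.2 hx

theorem latticeToReal_mem_realTangentCone (ha : a ∈ idealSupport (monomialIdeal K A))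
    {v : Fin n → ℤ} (hv : v ∈ idealTangentCone A a) :
    latticeToReal v ∈ realTangentCone (newtonPolyhedron (monomialIdeal K A))
      (latticeToReal (toLattice a)) := by
  obtain ⟨ε, hε, h⟩ := exists_pos_smul_mem_newtonPolyhedron ha hv
  have h1 : (ε⁻¹ : ℝ) • (ε • latticeToReal v) ∈
      realTangentCone (newtonPolyhedron (monomialIdeal K A)) (latticeToReal (toLattice a)) := by
    refine PointedCone.smul_mem _ (inv_nonneg.mpr hε.le) (Submodule.subset_span ⟨_, h, ?_⟩)
    simp
  rwa [smul_smul, inv_mul_cancel₀ hε.ne', one_smul] at h1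

/-- For the nontrivial inclusion, each dual basis functional is nonnegative on all `s - a` with `s`
in the support, hence on the real tangent cone; a lattice point there has nonnegative coordinates.
-/
theorem idealTangentCone_eq_of_isSimplicial (ha : a ∈ idealSupport (monomialIdeal K A))
    (h : IsSimplicial (idealTangentCone A a)) :
    (idealTangentCone A a : Set (Fin n → ℤ)) =
      {v | latticeToReal v ∈ realTangentCone (newtonPolyhedron (monomialIdeal K A))
        (latticeToReal (toLattice a))} := by
  obtain ⟨-, S, hS, hcard⟩ := h
  have hM := single_mem_idealTangentCone A a
  refine Set.Subset.antisymm (fun v hv => latticeToReal_mem_realTangentCone ha hv) fun v hv => ?_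
  refine (mem_iff_latticeBasis_repr_nonneg hS.1 hM hcard v).mpr fun s => ?_
  have := nonneg_of_mem_realTangentCone
    (realExtension ((latticeBasis hS.1 hM hcard).coord s)) ?_ hv
  · rw [realExtension_latticeToReal] at this
    exact_mod_cast this
  · intro t ht
    rw [← latticeToReal_sub, realExtension_latticeToReal]
    exact_mod_cast (mem_iff_latticeBasis_repr_nonneg hS.1 hM hcard _).mp
      (sub_mem_idealTangentCone_of_mem_idealSupport ht a) s

theorem isPrimitiveVector_of_isSimplicial (h : IsSimplicial (idealTangentCone A a))
    {S : Finset (Fin n → ℤ)} (hS : IsMinimalGeneratingSet S (idealTangentCone A a))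
    {v : Fin n → ℤ} (hv : v ∈ S) : IsPrimitiveVector v := by
  obtain ⟨hp, T, hT, hcard⟩ := h
  obtain rfl := hS.unique hp hT
  exact isPrimitiveVector_of_mem hS.1 (single_mem_idealTangentCone A a) hcard hv

theorem idealTangentCone_eq_top (h : NeighborsMem (idealSupport (monomialIdeal K A)) a) :
    idealTangentCone A a = ⊤ := by
  rw [eq_top_iff]
  intro v _
  rw [← (Pi.basisFun ℤ (Fin n)).sum_repr v]
  refine sum_mem fun i _ => ?_
  rw [Pi.basisFun_apply]
  obtain ⟨k, hk | hk⟩ := Int.eq_nat_or_neg ((Pi.basisFun ℤ (Fin n)).repr v i)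
  · rw [hk, natCast_zsmul]
    exact nsmul_mem (single_mem_idealTangentCone A a i) k
  · rw [hk, neg_smul, natCast_zsmul, ← smul_neg]
    obtain ⟨s, hs, hsa⟩ := (h i).2
    have := sub_mem_idealTangentCone_of_mem_idealSupport hs a
    rw [hsa, sub_sub_cancel_left] at this
    exact nsmul_mem this k

end TangentCone

/-! ### The chart as the spectrum of a monoid ring -/

section ChartRing

variable {n : ℕ} (K : Type u) [Field K] (A : Set (Fin n →₀ ℕ)) (a : Fin n →₀ ℕ)

/-- The inclusion of the polynomial ring into the Laurent polynomial ring. -/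
noncomputable def toLaurent (n : ℕ) :
    MvPolynomial (Fin n) K →ₐ[K] AddMonoidAlgebra K (Fin n → ℤ) :=
  MvPolynomial.aeval fun i => AddMonoidAlgebra.single (Pi.single i 1) 1

theorem toLaurent_monomial (c : Fin n →₀ ℕ) (r : K) :
    toLaurent K n (MvPolynomial.monomial c r) = AddMonoidAlgebra.single (toLattice c) r := by
  rw [toLaurent, MvPolynomial.aeval_monomial]
  have h : (c.prod fun i k => (AddMonoidAlgebra.single (Pi.single i 1 : Fin n → ℤ) (1 : K)) ^ k) =
      AddMonoidAlgebra.single (toLattice c) 1 := by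
    induction c using Finsupp.induction_linear with
    | zero => simp [toLattice_zero, AddMonoidAlgebra.one_def]
    | add f g hf hg =>
      rw [Finsupp.prod_add_index' (by simp) (by intros; rw [pow_add]), hf, hg,
        AddMonoidAlgebra.single_mul_single, toLattice_add, one_mul]
    | single i k =>
      rw [Finsupp.prod_single_index (h := fun i k =>
          (AddMonoidAlgebra.single (Pi.single i 1 : Fin n → ℤ) (1 : K)) ^ k) (pow_zero _),
        AddMonoidAlgebra.single_pow, one_pow, ← toLattice_single]
      congr 1
      ext j
      simp [toLattice, Finsupp.single_apply]
  rw [h, ← Algebra.smul_def, AddMonoidAlgebra.smul_single, smul_eq_mul, mul_one]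

theorem coeff_toLaurent (f : MvPolynomial (Fin n) K) (c : Fin n →₀ ℕ) :
    (toLaurent K n f).coeff (toLattice c) = f.coeff c := by
  classical
  induction f using MvPolynomial.induction_on' with
  | monomial d r =>
    rw [toLaurent_monomial, MvPolynomial.coeff_monomial, AddMonoidAlgebra.coeff_single,
      Finsupp.single_apply]
    simp only [toLattice_injective.eq_iff]
  | add p q hp hq => rw [map_add, MvPolynomial.coeff_add, AddMonoidAlgebra.coeff_add,
      Finsupp.add_apply, hp, hq]

theorem toLaurent_injective : Function.Injective (toLaurent K n) := by
  intro f g h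
  ext c
  rw [← coeff_toLaurent, h, coeff_toLaurent]

/-- The inclusion of the monoid ring of a submonoid of the lattice into the Laurent polynomial
ring. -/
noncomputable def monoidRingIncl (M : AddSubmonoid (Fin n → ℤ)) :
    AddMonoidAlgebra K M →ₐ[K] AddMonoidAlgebra K (Fin n → ℤ) :=
  AddMonoidAlgebra.mapDomainAlgHom K K M.subtype

theorem monoidRingIncl_single (M : AddSubmonoid (Fin n → ℤ)) (m : M) (r : K) :
    monoidRingIncl K M (AddMonoidAlgebra.single m r) = AddMonoidAlgebra.single (m : Fin n → ℤ) r :=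
  AddMonoidAlgebra.mapDomain_single

theorem monoidRingIncl_injective (M : AddSubmonoid (Fin n → ℤ)) :
    Function.Injective (monoidRingIncl K M) :=
  AddMonoidAlgebra.mapDomain_injective Subtype.val_injective

/-- The homomorphism from the Rees algebra to the Laurent polynomial ring that dehomogenizes with
respect to `x^a t`, that is, sends `t` to `x^(-a)`. -/
noncomputable def reesToLaurent (I : Ideal (MvPolynomial (Fin n) K)) :
    reesAlgebra I →+* AddMonoidAlgebra K (Fin n → ℤ) :=
  (Polynomial.eval₂RingHom (toLaurent K n : _ →+* _)
    (AddMonoidAlgebra.single (-toLattice a) 1)).comp (reesAlgebra I).val.toRingHom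

theorem reesToLaurent_monomial (I : Ideal (MvPolynomial (Fin n) K)) (d : ℕ)
    (r : MvPolynomial (Fin n) K) (h) :
    reesToLaurent K a I ⟨Polynomial.monomial d r, h⟩ =
      toLaurent K n r * AddMonoidAlgebra.single (-(d • toLattice a)) 1 := by
  simp [reesToLaurent, AddMonoidAlgebra.single_pow]

/-- The Rees algebra is generated by its parts of degree 0 and 1, and on these the exponents
produced are `c` and `c + (b - a)` with `c ∈ ℕⁿ`, `b ∈ A`. -/
theorem reesToLaurent_mem_range (f : reesAlgebra (monomialIdeal K A)) :
    reesToLaurent K a _ f ∈ (monoidRingIncl K (idealTangentCone A a)).range := by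
  have hpoly (r : MvPolynomial (Fin n) K) :
      toLaurent K n r ∈ (monoidRingIncl K (idealTangentCone A a)).range := by
    induction r using MvPolynomial.induction_on' with
    | monomial c r =>
      exact ⟨AddMonoidAlgebra.single ⟨_, toLattice_mem_idealTangentCone A a c⟩ r, by
        rw [toLaurent_monomial]; exact monoidRingIncl_single K _ _ _⟩
    | add p q hp hq => rw [map_add]; exact add_mem hp hq
  have hlin (r : MvPolynomial (Fin n) K) (hr : r ∈ monomialIdeal K A) :
      toLaurent K n r * AddMonoidAlgebra.single (-(1 • toLattice a)) 1 ∈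
        (monoidRingIncl K (idealTangentCone A a)).range := by
    rw [monomialIdeal] at hr
    induction hr using Submodule.span_induction with
    | mem x hx =>
      obtain ⟨b, hb, rfl⟩ := hx
      refine ⟨AddMonoidAlgebra.single ⟨_, sub_mem_idealTangentCone hb a⟩ 1, ?_⟩
      rw [toLaurent_monomial, AddMonoidAlgebra.single_mul_single, one_smul, one_mul,
        ← sub_eq_add_neg]
      exact monoidRingIncl_single K _ _ _
    | zero => rw [map_zero, zero_mul]; exact zero_mem _
    | add x y _ _ hx hy => rw [map_add, add_mul]; exact add_mem hx hy
    | smul c x _ hx => rw [smul_eq_mul, map_mul, mul_assoc]; exact mul_mem (hpoly c) hx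
  obtain ⟨f, hf⟩ := f
  have hf' := hf
  rw [← adjoin_monomial_eq_reesAlgebra] at hf'
  induction hf' using Algebra.adjoin_induction with
  | mem f hf0 =>
    obtain ⟨r, hr, rfl⟩ := hf0
    have h1 := hlin r hr
    rw [← reesToLaurent_monomial K a (monomialIdeal K A) 1 r hf] at h1
    exact h1
  | algebraMap r =>
    have h1 : toLaurent K n r * AddMonoidAlgebra.single (-(0 • toLattice a)) 1 ∈
        (monoidRingIncl K (idealTangentCone A a)).range := by
      rw [zero_smul, neg_zero, ← AddMonoidAlgebra.one_def, mul_one]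
      exact hpoly r
    rw [← reesToLaurent_monomial K a (monomialIdeal K A) 0 r hf] at h1
    exact h1
  | add f g hfm hgm hf' hg' =>
    rw [adjoin_monomial_eq_reesAlgebra] at hfm hgm
    have := add_mem (hf' hfm) (hg' hgm)
    rwa [← map_add] at this
  | mul f g hfm hgm hf' hg' =>
    rw [adjoin_monomial_eq_reesAlgebra] at hfm hgm
    have := mul_mem (hf' hfm) (hg' hgm)
    rwa [← map_mul] at this

variable {A a}

theorem monomial_mem_reesGrading (I : Ideal (MvPolynomial (Fin n) K)) {d e : ℕ} (h : e = d)
    (r : MvPolynomial (Fin n) K) (hr) :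
    (⟨Polynomial.monomial e r, hr⟩ : reesAlgebra I) ∈ reesGrading I d :=
  fun _ hi => Polynomial.coeff_monomial_of_ne _ (h ▸ hi)

/-- The element `x^a t` of the Rees algebra. -/
noncomputable def chartElement (ha : a ∈ idealSupport (monomialIdeal K A)) :
    reesAlgebra (monomialIdeal K A) :=
  ⟨Polynomial.monomial 1 (MvPolynomial.monomial a (1 : K)),
    reesAlgebra.monomial_mem.mpr (by rw [pow_one]; exact ha)⟩

theorem chartElement_mem (ha : a ∈ idealSupport (monomialIdeal K A)) :
    chartElement K ha ∈ reesGrading (monomialIdeal K A) 1 :=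
  monomial_mem_reesGrading K _ rfl _ _

theorem reesToLaurent_chartElement (ha : a ∈ idealSupport (monomialIdeal K A)) :
    reesToLaurent K a _ (chartElement K ha) = 1 := by
  rw [chartElement, reesToLaurent_monomial, toLaurent_monomial,
    AddMonoidAlgebra.single_mul_single, one_smul, add_neg_cancel, one_mul,
    AddMonoidAlgebra.one_def]

/-- The coordinate ring of the chart. -/
abbrev ChartRing (ha : a ∈ idealSupport (monomialIdeal K A)) : Type u :=
  HomogeneousLocalization.Away (reesGrading (monomialIdeal K A)) (chartElement K ha)

/-- The inclusion of the coordinate ring of the chart into the Laurent polynomial ring. -/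
noncomputable def chartRingToLaurent (ha : a ∈ idealSupport (monomialIdeal K A)) :
    ChartRing K ha →+* AddMonoidAlgebra K (Fin n → ℤ) :=
  (IsLocalization.Away.lift (S := Localization.Away (chartElement K ha))
    (chartElement K ha) (g := reesToLaurent K a _)
    (by rw [reesToLaurent_chartElement]; exact isUnit_one)).comp
    (algebraMap (ChartRing K ha) (Localization.Away (chartElement K ha)))

theorem chartRingToLaurent_mk (ha : a ∈ idealSupport (monomialIdeal K A)) (d : ℕ)
    (f : reesAlgebra (monomialIdeal K A)) (hf) :
    chartRingToLaurent K ha (HomogeneousLocalization.Away.mk _ (chartElement_mem K ha) d f hf) =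
      reesToLaurent K a _ f := by
  rw [chartRingToLaurent, RingHom.comp_apply, HomogeneousLocalization.algebraMap_apply,
    HomogeneousLocalization.Away.val_mk, Localization.mk_eq_mk', IsLocalization.Away.lift,
    IsLocalization.lift_mk'_spec]
  simp [reesToLaurent_chartElement]

/-- A fraction `r t^d / (x^a t)^d` maps to `r x^(-da)`, and `x^(-da)` is a unit among Laurent
polynomials. -/
theorem chartRingToLaurent_injective (ha : a ∈ idealSupport (monomialIdeal K A)) :
    Function.Injective (chartRingToLaurent K ha) := by
  rw [injective_iff_map_eq_zero]
  intro x hx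
  obtain ⟨d, f, hf, rfl⟩ := HomogeneousLocalization.Away.mk_surjective _ (chartElement_mem K ha) x
  rw [chartRingToLaurent_mk] at hx
  have hf0 : f = ⟨Polynomial.monomial (d • 1) ((f : Polynomial _).coeff (d • 1)),
      reesAlgebra.monomial_mem.mpr (f.2 _)⟩ := by
    apply Subtype.ext
    ext1 i
    by_cases hi : i = d • 1
    · simp [hi]
    · rw [hf i hi, Polynomial.coeff_monomial_of_ne _ hi]
  rw [hf0, reesToLaurent_monomial] at hx
  have h1 : toLaurent K n ((f : Polynomial _).coeff (d • 1)) = 0 := by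
    have := congrArg (· * AddMonoidAlgebra.single ((d • 1) • toLattice a) (1 : K)) hx
    simpa [mul_assoc, AddMonoidAlgebra.single_mul_single, ← AddMonoidAlgebra.one_def] using this
  have h2 : f = 0 := by
    refine hf0.trans (Subtype.ext ?_)
    exact (congrArg _ ((map_eq_zero_iff _ (toLaurent_injective K)).mp h1)).trans (map_zero _)
  subst h2
  apply HomogeneousLocalization.val_injective
  rw [HomogeneousLocalization.Away.val_mk, Localization.mk_zero, HomogeneousLocalization.val_zero]

theorem range_chartRingToLaurent (ha : a ∈ idealSupport (monomialIdeal K A)) :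
    (chartRingToLaurent K ha).rangeS =
      (monoidRingIncl K (idealTangentCone A a)).toRingHom.rangeS := by
  apply le_antisymm
  · rintro _ ⟨x, rfl⟩
    obtain ⟨d, f, hf, rfl⟩ :=
      HomogeneousLocalization.Away.mk_surjective _ (chartElement_mem K ha) x
    rw [chartRingToLaurent_mk]
    exact reesToLaurent_mem_range K A a f
  · have hpoly (r : MvPolynomial (Fin n) K) : toLaurent K n r ∈ (chartRingToLaurent K ha).rangeS := by
      refine ⟨HomogeneousLocalization.Away.mk _ (chartElement_mem K ha) 0
        ⟨Polynomial.monomial 0 r, reesAlgebra.monomial_mem.mpr (by simp)⟩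
        (monomial_mem_reesGrading K _ (by simp) _ _), ?_⟩
      rw [chartRingToLaurent_mk, reesToLaurent_monomial]
      simp [← AddMonoidAlgebra.one_def]
    have hmono (m : Fin n → ℤ) (hm : m ∈ idealTangentCone A a) :
        AddMonoidAlgebra.single m (1 : K) ∈ (chartRingToLaurent K ha).rangeS := by
      rw [idealTangentCone_eq_closure] at hm
      induction hm using AddSubmonoid.closure_induction with
      | mem m hm =>
        rcases hm with ⟨b, hb, rfl⟩ | ⟨i, rfl⟩
        · refine ⟨HomogeneousLocalization.Away.mk _ (chartElement_mem K ha) 1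
            (chartElement K (subset_idealSupport K hb.1))
            (chartElement_mem K _), ?_⟩
          rw [chartRingToLaurent_mk, chartElement, reesToLaurent_monomial, toLaurent_monomial,
            AddMonoidAlgebra.single_mul_single, one_smul, one_mul, ← sub_eq_add_neg]
        · simp only [← toLattice_single]
          rw [← toLaurent_monomial]
          exact hpoly _
      | zero => rw [← AddMonoidAlgebra.one_def]; exact one_mem _
      | add x y _ _ hx hy =>
        have := mul_mem hx hy
        rwa [AddMonoidAlgebra.single_mul_single, one_mul] at this
    rintro _ ⟨x, rfl⟩
    induction x using AddMonoidAlgebra.induction_linear with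
    | zero => rw [map_zero]; exact zero_mem _
    | add x y hx hy => rw [map_add]; exact add_mem hx hy
    | single m r =>
      have := mul_mem (hpoly (MvPolynomial.C r)) (hmono m m.2)
      rw [← MvPolynomial.monomial_zero', toLaurent_monomial, AddMonoidAlgebra.single_mul_single,
        toLattice_zero, zero_add, mul_one] at this
      exact (congrArg (· ∈ (chartRingToLaurent K ha).rangeS) (monoidRingIncl_single K _ m r)).mpr this

/-- The coordinate ring of the `a`-chart is the monoid ring of the ideal tangent cone. -/
noncomputable def chartRingEquiv (ha : a ∈ idealSupport (monomialIdeal K A)) :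
    ChartRing K ha ≃+* AddMonoidAlgebra K (idealTangentCone A a) :=
  ((RingEquiv.ofBijective (chartRingToLaurent K ha).rangeSRestrict
    ⟨fun _ _ h => chartRingToLaurent_injective K ha (congrArg Subtype.val h),
      RingHom.rangeSRestrict_surjective _⟩).trans
    (RingEquiv.subsemiringCongr (range_chartRingToLaurent K ha))).trans
    (RingEquiv.ofBijective
      (monoidRingIncl K (idealTangentCone A a)).toRingHom.rangeSRestrict
    ⟨fun _ _ h => monoidRingIncl_injective K _ (congrArg Subtype.val h),
      RingHom.rangeSRestrict_surjective _⟩).symm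

theorem monoidRingIncl_chartRingEquiv (ha : a ∈ idealSupport (monomialIdeal K A))
    (x : ChartRing K ha) :
    monoidRingIncl K _ (chartRingEquiv K ha x) = chartRingToLaurent K ha x := by
  let e := RingEquiv.ofBijective
      (monoidRingIncl K (idealTangentCone A a)).toRingHom.rangeSRestrict
    ⟨fun _ _ h => monoidRingIncl_injective K _ (congrArg Subtype.val h),
      RingHom.rangeSRestrict_surjective _⟩
  have h (y) : monoidRingIncl K (idealTangentCone A a) (e.symm y) = y.1 :=
    congrArg Subtype.val (e.apply_symm_apply y)
  exact h _

/-- The structure map of the coordinate ring of the chart over the base field. -/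
noncomputable def chartRingStructure (ha : a ∈ idealSupport (monomialIdeal K A)) :
    K →+* ChartRing K ha :=
  (HomogeneousLocalization.fromZeroRingHom _ _).comp
    ((algebraMap (MvPolynomial (Fin n) K) (reesGrading (monomialIdeal K A) 0)).comp
      (algebraMap K (MvPolynomial (Fin n) K)))

theorem chartRingEquiv_comp_structure (ha : a ∈ idealSupport (monomialIdeal K A)) :
    (chartRingEquiv K ha : _ →+* _).comp (chartRingStructure K ha) =
      algebraMap K (AddMonoidAlgebra K (idealTangentCone A a)) := by
  ext1 r
  apply monoidRingIncl_injective
  rw [AlgHom.commutes]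
  refine (monoidRingIncl_chartRingEquiv K ha _).trans ?_
  -- A scalar is a fraction whose denominator is the zeroth power of `x^a t`.
  have : chartRingStructure K ha r = HomogeneousLocalization.Away.mk _ (chartElement_mem K ha) 0
      ⟨Polynomial.monomial 0 (MvPolynomial.C r), reesAlgebra.monomial_mem.mpr (by simp)⟩
        (monomial_mem_reesGrading K _ (by simp) _ _) := by
    apply HomogeneousLocalization.val_injective
    rw [HomogeneousLocalization.Away.val_mk]
    rfl
  rw [this, chartRingToLaurent_mk, reesToLaurent_monomial, ← MvPolynomial.algebraMap_eq,
    AlgHom.commutes]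
  simp [← AddMonoidAlgebra.one_def]

theorem exists_monomialChart_iso (ha : a ∈ idealSupport (monomialIdeal K A)) :
    ∃ e : (monomialChart K A a ha).toScheme ≅
        Spec (CommRingCat.of (AddMonoidAlgebra K (idealTangentCone A a))),
      e.hom ≫ Spec.map (CommRingCat.ofHom
        (algebraMap K (AddMonoidAlgebra K (idealTangentCone A a)))) =
          monomialChartStructure K A a ha := by
  let e₁ : (monomialChart K A a ha).toScheme ≅ Spec (CommRingCat.of (ChartRing K ha)) := Proj.basicOpenIsoSpec (reesGrading (monomialIdeal K A)) (chartElement K ha)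
    (chartElement_mem K ha) one_pos
  let e₂ : Spec (CommRingCat.of (ChartRing K ha)) ≅
      Spec (CommRingCat.of (AddMonoidAlgebra K (idealTangentCone A a))) :=
    { hom := Spec.map (CommRingCat.ofHom ((chartRingEquiv K ha).symm : _ →+* _))
      inv := Spec.map (CommRingCat.ofHom (chartRingEquiv K ha : _ →+* _))
      hom_inv_id := by
        rw [← Spec.map_comp, ← CommRingCat.ofHom_comp, ← Spec.map_id]
        congr 2
        exact RingHom.ext (chartRingEquiv K ha).symm_apply_apply
      inv_hom_id := by
        rw [← Spec.map_comp, ← CommRingCat.ofHom_comp, ← Spec.map_id]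
        congr 2
        exact RingHom.ext (chartRingEquiv K ha).apply_symm_apply }
  refine ⟨e₁ ≪≫ e₂, ?_⟩
  have h₂ : e₂.hom ≫ Spec.map (CommRingCat.ofHom
        (algebraMap K (AddMonoidAlgebra K (idealTangentCone A a)))) =
      Spec.map (CommRingCat.ofHom (chartRingStructure K ha)) := by
    rw [← chartRingEquiv_comp_structure K ha, ← Spec.map_comp, ← CommRingCat.ofHom_comp]
    congr 2
    exact RingHom.ext fun x => (chartRingEquiv K ha).symm_apply_apply _
  have h₁ : (Proj.basicOpen (reesGrading (monomialIdeal K A)) (chartElement K ha)).ι ≫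
      Proj.toSpecZero (reesGrading (monomialIdeal K A)) =
      e₁.hom ≫ Spec.map (CommRingCat.ofHom (HomogeneousLocalization.fromZeroRingHom
        (reesGrading (monomialIdeal K A)) (Submonoid.powers (chartElement K ha)))) := by
    rw [← Proj.awayι_toSpecZero (reesGrading (monomialIdeal K A)) (chartElement K ha)
      (chartElement_mem K ha) one_pos, ← Proj.basicOpenIsoSpec_inv_ι, Category.assoc]
    exact (Iso.hom_inv_id_assoc e₁ _).symm
  rw [Iso.trans_hom, Category.assoc, h₂]
  change _ = (Proj.basicOpen (reesGrading (monomialIdeal K A)) (chartElement K ha)).ι ≫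
    (Proj.toSpecZero (reesGrading (monomialIdeal K A)) ≫ Spec.map _) ≫ Spec.map _
  rw [Category.assoc, ← Category.assoc _ (Proj.toSpecZero _), h₁]
  refine Eq.trans ?_ (Category.assoc _ _ _).symm
  refine congrArg (e₁.hom ≫ ·) ?_
  rw [← Spec.map_comp, ← Spec.map_comp]
  rfl

end ChartRing

/-! ### Smoothness of monoid rings of pointed monoids -/

section Smoothness

variable {n : ℕ} (K : Type u) [Field K] {M : AddSubmonoid (Fin n → ℤ)} {S : Finset (Fin n → ℤ)}

open Classical in
/-- The homomorphism from the monoid ring of a pointed monoid that maps the minimal generators to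
given elements with vanishing products, and the other nonzero elements of the monoid to zero. -/
noncomputable def squareZeroHom (hS : IsMinimalGeneratingSet S M) (hM : IsPointedMonoid M)
    {C : Type*} [CommRing C] [Algebra K C] (y : (Fin n → ℤ) → C) (hy : ∀ s t, y s * y t = 0) :
    AddMonoidAlgebra K M →ₐ[K] C :=
  AddMonoidAlgebra.lift K C M
    { toFun := fun m => if m.toAdd = 0 then 1 else
        if (m.toAdd : Fin n → ℤ) ∈ S then y m.toAdd else 0
      map_one' := by simp
      map_mul' := by
        intro m₁ m₂
        obtain ⟨m₁, h₁⟩ := m₁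
        obtain ⟨m₂, h₂⟩ := m₂
        change (if (⟨m₁, h₁⟩ + ⟨m₂, h₂⟩ : M) = 0 then (1 : C) else
          if m₁ + m₂ ∈ S then y (m₁ + m₂) else 0) =
          (if (⟨m₁, h₁⟩ : M) = 0 then 1 else if m₁ ∈ S then y m₁ else 0) *
          (if (⟨m₂, h₂⟩ : M) = 0 then 1 else if m₂ ∈ S then y m₂ else 0)
        by_cases h10 : m₁ = 0
        · subst h10; simp
        by_cases h20 : m₂ = 0
        · subst h20; simp
        -- A sum of two nonzero elements is neither zero, by pointedness, nor a minimal generator,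
        -- by irreducibility; so its value is 0.
        have h0 : m₁ + m₂ ≠ 0 := fun h =>
          h20 (hM m₂ h₂ (by rwa [← eq_neg_of_add_eq_zero_left h]))
        have hnS : m₁ + m₂ ∉ S := fun h =>
          (hS.eq_zero_or_eq_zero hM h h₁ h₂ rfl).elim h10 h20
        simp only [AddMemClass.mk_add_mk, AddSubmonoid.mk_eq_zero, h0, hnS, h10, h20, if_false]
        split_ifs <;> simp [hy] }

theorem squareZeroHom_single (hS : IsMinimalGeneratingSet S M) (hM : IsPointedMonoid M)
    {C : Type*} [CommRing C] [Algebra K C] (y : (Fin n → ℤ) → C) (hy : ∀ s t, y s * y t = 0)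
    (s : M) (hs : (s : Fin n → ℤ) ∈ S) :
    squareZeroHom K hS hM y hy (AddMonoidAlgebra.single s 1) = y s := by
  have h0 : s ≠ 0 := fun h => hS.ne_zero hs (by rw [h]; rfl)
  simp [squareZeroHom, AddMonoidAlgebra.lift_single, h0, hs]

-- Factoring out `X ^ k.degree` leaves a product with constant term the monomial of exponent `k`:
-- the lowest term of the product records `k` completely.
open Polynomial in
theorem coeff_prod_pow_of_leading {ι : Type*} [Fintype ι] (p q : ι → (MvPolynomial ι K)[X])
    (hp : ∀ i, p i = X * (C (MvPolynomial.X i) + X * q i)) (k : ι →₀ ℕ) {j : ℕ}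
    (hj : j ≤ k.degree) : (∏ i, p i ^ k i).coeff j =
      if j = k.degree then MvPolynomial.monomial k 1 else 0 := by
  have h : ∏ i, p i ^ k i = X ^ k.degree * ∏ i, (C (MvPolynomial.X i) + X * q i) ^ k i := by
    simp_rw [hp, mul_pow, Finset.prod_mul_distrib]
    rw [Finset.prod_pow_eq_pow_sum, Finsupp.degree_eq_sum]
  rw [h, coeff_X_pow_mul']
  rcases hj.eq_or_lt with rfl | hj
  · simp only [le_refl, if_true, Nat.sub_self, coeff_zero_eq_eval_zero, eval_prod, eval_pow,
      eval_add, eval_C, eval_mul, eval_X, zero_mul, add_zero]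
    rw [MvPolynomial.monomial_eq, Finsupp.prod_fintype _ _ (by simp)]
    simp
  · rw [if_neg (not_le.mpr hj), if_neg hj.ne]

/-- If the monoid ring of a pointed monoid is formally smooth, then the tangent vectors at the
origin given by the minimal generators lift to infinitesimal arcs of arbitrary order. -/
theorem exists_lift_of_formallySmooth (hS : IsMinimalGeneratingSet S M) (hM : IsPointedMonoid M)
    [Algebra.FormallySmooth K (AddMonoidAlgebra K M)] {P : Type*} [CommRing P] [Algebra K P]
    (x : P) (c : S → P) (N : ℕ) :
    ∃ (f : AddMonoidAlgebra K M →ₐ[K] P ⧸ Ideal.span {x ^ N}) (q : S → P), ∀ s : S,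
      f (AddMonoidAlgebra.single ⟨s, hS.mem s.2⟩ 1) =
        Ideal.Quotient.mk _ (x * (c s + x * q s)) := by
  classical
  let mk : P →+* P ⧸ Ideal.span {x ^ N} := Ideal.Quotient.mk _
  -- Modulo `x ^ 2` the elements `x * c s` have vanishing products, so `squareZeroHom` applies. The
  -- ideal is nilpotent modulo `x ^ N`, so the homomorphism lifts, with an ambiguity in multiples of
  -- `x ^ 2`.
  let I : Ideal (P ⧸ Ideal.span {x ^ N}) := Ideal.map mk (Ideal.span {x ^ 2})
  have hI : IsNilpotent I := by
    refine ⟨N, ?_⟩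
    have h0 : mk ((x ^ 2) ^ N) = 0 := by
      rw [Ideal.Quotient.eq_zero_iff_mem, Ideal.mem_span_singleton, ← pow_mul]
      exact pow_dvd_pow _ (by omega)
    have h1 : I ^ N = Ideal.map mk (Ideal.span {x ^ 2} ^ N) := (Ideal.map_pow _ _ _).symm
    rw [h1, Ideal.span_singleton_pow, Ideal.map_span, Set.image_singleton, h0,
      Ideal.span_singleton_zero, Ideal.zero_eq_bot]
  let c' : (Fin n → ℤ) → P := fun s => if h : s ∈ S then x * c ⟨s, h⟩ else 0
  have hc' (s) : x ∣ c' s := by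
    by_cases h : s ∈ S
    · exact ⟨c ⟨s, h⟩, dif_pos h⟩
    · exact ⟨0, (dif_neg h).trans (mul_zero x).symm⟩
  let y : (Fin n → ℤ) → (P ⧸ Ideal.span {x ^ N}) ⧸ I := fun s => Ideal.Quotient.mk I (mk (c' s))
  have hy (s t) : y s * y t = 0 := by
    rw [← map_mul, ← map_mul, Ideal.Quotient.eq_zero_iff_mem]
    refine Ideal.mem_map_of_mem _ (Ideal.mem_span_singleton.mpr ?_)
    rw [sq]
    exact mul_dvd_mul (hc' s) (hc' t)
  obtain ⟨f, hf⟩ := Algebra.FormallySmooth.exists_lift I hI (squareZeroHom K hS hM y hy)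
  have key (s : S) : ∃ q : P, f (AddMonoidAlgebra.single ⟨s, hS.mem s.2⟩ 1) =
      mk (x * (c s + x * q)) := by
    have h1 := AlgHom.congr_fun hf (AddMonoidAlgebra.single ⟨s, hS.mem s.2⟩ 1)
    rw [squareZeroHom_single K hS hM y hy ⟨s, hS.mem s.2⟩ s.2] at h1
    have h2 : f (AddMonoidAlgebra.single ⟨s, hS.mem s.2⟩ 1) - mk (c' s) ∈ I :=
      Ideal.Quotient.eq.mp h1
    obtain ⟨r, hr, hr'⟩ :=
      (Ideal.mem_map_iff_of_surjective mk Ideal.Quotient.mk_surjective).mp h2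
    obtain ⟨q, rfl⟩ := Ideal.mem_span_singleton.mp hr
    refine ⟨q, ?_⟩
    rw [eq_sub_iff_add_eq] at hr'
    rw [← hr', ← map_add]
    congr 1
    rw [show c' s = x * c s from dif_pos s.2]
    ring
  choose q hq using key
  exact ⟨f, q, hq⟩

open Polynomial in
/-- If the monoid ring of a pointed monoid is formally smooth, then there are no relations between
the minimal generators of the monoid. -/
theorem eq_of_sum_eq_of_formallySmooth (hS : IsMinimalGeneratingSet S M) (hM : IsPointedMonoid M)
    [Algebra.FormallySmooth K (AddMonoidAlgebra K M)] (k l : S →₀ ℕ)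
    (hkl : ∑ s, k s • (s : Fin n → ℤ) = ∑ s, l s • (s : Fin n → ℤ)) : k = l := by
  classical
  -- Large enough for the lowest terms of both products to survive modulo `X ^ N`.
  let N := k.degree + l.degree + 1
  obtain ⟨f, q, hq⟩ := exists_lift_of_formallySmooth K hS hM
    (X : (MvPolynomial S K)[X]) (fun s => C (MvPolynomial.X s)) N
  let g : S → M := fun s => ⟨s, hS.mem s.2⟩
  have hprod (m : S →₀ ℕ) : f (AddMonoidAlgebra.single (∑ s, m s • g s) 1) =
      Ideal.Quotient.mk _ (∏ s, (X * (C (MvPolynomial.X s) + X * q s)) ^ m s) := by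
    have h1 : AddMonoidAlgebra.single (∑ s, m s • g s) (1 : K) =
        ∏ s, AddMonoidAlgebra.single (g s) (1 : K) ^ m s := by
      simp only [AddMonoidAlgebra.single_pow, one_pow]
      induction (Finset.univ : Finset S) using Finset.induction_on with
      | empty => simp [AddMonoidAlgebra.one_def]
      | insert a s ha ih =>
        rw [Finset.sum_insert ha, Finset.prod_insert ha, ← ih,
          AddMonoidAlgebra.single_mul_single, one_mul]
    rw [h1, map_prod, map_prod]
    exact Finset.prod_congr rfl fun s _ => by rw [map_pow, map_pow, hq]
  have hsum : ∑ s, k s • g s = ∑ s, l s • g s := by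
    apply Subtype.ext
    simpa [g] using hkl
  have hdvd : (X : (MvPolynomial S K)[X]) ^ N ∣ ∏ s, (X * (C (MvPolynomial.X s) + X * q s)) ^ k s -
      ∏ s, (X * (C (MvPolynomial.X s) + X * q s)) ^ l s := by
    rw [← Ideal.mem_span_singleton, ← Ideal.Quotient.eq]
    exact (hprod k).symm.trans ((congrArg (fun m => f (AddMonoidAlgebra.single m 1)) hsum).trans
      (hprod l))
  rw [X_pow_dvd_iff] at hdvd
  have hk (j) (hj : j ≤ k.degree) := coeff_prod_pow_of_leading K _ q (fun _ => rfl) k hj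
  have hl (j) (hj : j ≤ l.degree) := coeff_prod_pow_of_leading K _ q (fun _ => rfl) l hj
  have hne (m : S →₀ ℕ) : MvPolynomial.monomial m (1 : K) ≠ 0 := by simp
  rcases lt_trichotomy k.degree l.degree with h | h | h
  · have := hdvd k.degree (by omega)
    rw [coeff_sub, hk _ le_rfl, hl _ h.le, if_pos rfl, if_neg h.ne, sub_zero] at this
    exact absurd this (hne k)
  · have := hdvd k.degree (by omega)
    rw [coeff_sub, hk _ le_rfl, hl _ h.le, if_pos rfl, if_pos h, sub_eq_zero] at this
    exact MvPolynomial.monomial_left_injective one_ne_zero this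
  · have := hdvd l.degree (by omega)
    rw [coeff_sub, hk _ h.le, hl _ le_rfl, if_neg h.ne, if_pos rfl, zero_sub, neg_eq_zero] at this
    exact absurd this (hne l)

theorem card_eq_of_formallySmooth (hS : IsMinimalGeneratingSet S M) (hM : IsPointedMonoid M)
    (hMe : ∀ i, Pi.single i 1 ∈ M) [Algebra.FormallySmooth K (AddMonoidAlgebra K M)] :
    S.card = n := by
  have hli : LinearIndependent ℤ (fun s : S => (s : Fin n → ℤ)) := by
    rw [Fintype.linearIndependent_iff]
    intro g hg s
    -- An integral relation is split into its positive and negative parts; equality of these forces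
    -- every coefficient to vanish.
    have h := eq_of_sum_eq_of_formallySmooth K hS hM
      (Finsupp.equivFunOnFinite.symm fun s => (g s).toNat)
      (Finsupp.equivFunOnFinite.symm fun s => (-g s).toNat) ?_
    · have := DFunLike.congr_fun h s
      simp only [Finsupp.equivFunOnFinite_symm_apply_apply] at this
      omega
    · rw [← sub_eq_zero, ← hg, ← Finset.sum_sub_distrib]
      refine Finset.sum_congr rfl fun s _ => ?_
      simp only [Finsupp.equivFunOnFinite_symm_apply_apply, ← natCast_zsmul]
      rw [← sub_smul, Int.toNat_sub_toNat_neg]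
  have hspan := span_eq_top_of_closure_eq hS.1 hMe
  have b : Module.Basis S ℤ (Fin n → ℤ) := Module.Basis.mk hli (by
    rw [Subtype.range_coe_subtype, Finset.setOfPred_mem]
    exact hspan.ge)
  have := Module.finrank_eq_card_basis b
  simpa using this.symm

theorem isSimplicial_iff_smooth (hM : IsPointedMonoid M) (hfg : M.FG)
    (hMe : ∀ i, Pi.single i 1 ∈ M) :
    Algebra.Smooth K (AddMonoidAlgebra K M) ↔ IsSimplicial M := by
  constructor
  · intro h
    have := h.formallySmooth
    obtain ⟨S, hS⟩ := exists_isMinimalGeneratingSet hfg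
    exact ⟨hM, S, hS, card_eq_of_formallySmooth K hS hM hMe⟩
  · rintro ⟨-, S, hS, hcard⟩
    -- The polynomial ring is the monoid ring of `S →₀ ℕ`, which `simplicialEquiv` identifies with
    -- `M`.
    have : Algebra.Smooth K (MvPolynomial S K) := {}
    exact Algebra.Smooth.of_equiv
      (AddMonoidAlgebra.domCongr K K (simplicialEquiv hS.1 hMe hcard))

theorem smooth_monomialChartStructure_iff {A : Set (Fin n →₀ ℕ)} {a : Fin n →₀ ℕ}
    (ha : a ∈ idealSupport (monomialIdeal K A)) :
    Smooth (monomialChartStructure K A a ha) ↔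
      Algebra.Smooth K (AddMonoidAlgebra K (idealTangentCone A a)) := by
  obtain ⟨e, he⟩ := exists_monomialChart_iso K ha
  have : MorphismProperty.RespectsIso (@Smooth.{u}) :=
    MorphismProperty.IsStableUnderBaseChange.respectsIso
  rw [← he, MorphismProperty.cancel_left_of_respectsIso @Smooth.{u},
    HasRingHomProperty.Spec_iff (P := @Smooth.{u}), CommRingCat.hom_ofHom, RingHom.smooth_algebraMap]

end Smoothness

/-! ### Covering by vertex charts, and torus charts -/

section Charts

variable {n : ℕ} (K : Type u) [Field K] {A : Set (Fin n →₀ ℕ)} {a : Fin n →₀ ℕ}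

open Classical in
/-- The element `x^s t` of the Rees algebra, or zero if `s` is not in the support. -/
noncomputable def reesMonomial (A : Set (Fin n →₀ ℕ)) (s : Fin n →₀ ℕ) :
    reesAlgebra (monomialIdeal K A) :=
  if hs : s ∈ idealSupport (monomialIdeal K A) then chartElement K hs else 0

theorem reesMonomial_of_mem {s : Fin n →₀ ℕ} (hs : s ∈ idealSupport (monomialIdeal K A)) :
    reesMonomial K A s = chartElement K hs := dif_pos hs

theorem coe_prod_reesMonomial (t : Finset (Fin n →₀ ℕ)) (k : (Fin n →₀ ℕ) → ℕ)
    (ht : ∀ s ∈ t, s ∈ idealSupport (monomialIdeal K A)) :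
    ((∏ s ∈ t, reesMonomial K A s ^ k s : reesAlgebra (monomialIdeal K A)) :
      Polynomial (MvPolynomial (Fin n) K)) =
      Polynomial.monomial (∑ s ∈ t, k s) (MvPolynomial.monomial (∑ s ∈ t, k s • s) 1) := by
  classical
  induction t using Finset.induction_on with
  | empty => rfl
  | insert s t hs ih =>
    rw [Finset.prod_insert hs, Finset.sum_insert hs, Finset.sum_insert hs, MulMemClass.coe_mul,
      ih fun u hu => ht u (Finset.mem_insert_of_mem hu),
      reesMonomial_of_mem K (ht s (Finset.mem_insert_self s t)), SubmonoidClass.coe_pow,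
      chartElement, Polynomial.monomial_pow, MvPolynomial.monomial_pow,
      Polynomial.monomial_mul_monomial, MvPolynomial.monomial_mul]
    simp

theorem prod_reesMonomial_eq (ha : a ∈ idealSupport (monomialIdeal K A))
    (t : Finset (Fin n →₀ ℕ)) (k : (Fin n →₀ ℕ) → ℕ)
    (ht : ∀ s ∈ t, s ∈ idealSupport (monomialIdeal K A))
    (hsum : ∑ s ∈ t, k s • s = (∑ s ∈ t, k s) • a) :
    ∏ s ∈ t, reesMonomial K A s ^ k s = chartElement K ha ^ (∑ s ∈ t, k s) := by
  apply Subtype.ext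
  rw [coe_prod_reesMonomial K t k ht, hsum, SubmonoidClass.coe_pow, chartElement,
    Polynomial.monomial_pow, MvPolynomial.monomial_pow, one_mul, one_pow]

theorem monomialChart_le_iSup (ha : a ∈ idealSupport (monomialIdeal K A)) :
    monomialChart K A a ha ≤
      ⨆ (v : Fin n →₀ ℕ) (hv : v ∈ A) (_ : IsNewtonVertex (monomialIdeal K A) v),
        monomialChart K A v (subset_idealSupport K hv) := by
  intro x hx
  have hmem {s : Fin n →₀ ℕ} (hs : s ∈ idealSupport (monomialIdeal K A)) :
      x ∈ monomialChart K A s hs ↔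
        chartElement K hs ∉ (x : Proj (reesGrading (monomialIdeal K A))).asHomogeneousIdeal.toIdeal :=
    Iff.rfl
  have hprime : (x : Proj (reesGrading (monomialIdeal K A))).asHomogeneousIdeal.toIdeal.IsPrime :=
    ProjectiveSpectrum.isPrime x
  -- The face condition holds because the point is a prime: if it contained a factor `x^s t` with
  -- positive exponent, it would contain a power of `x^b t`, hence `x^b t` itself.
  obtain ⟨b, ⟨hb, hbx⟩, hv⟩ := exists_isNewtonVertex_mem (I := monomialIdeal K A)
    (B := {b | ∃ hb : b ∈ idealSupport (monomialIdeal K A), x ∈ monomialChart K A b hb})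
    ⟨a, ha, hx⟩ (fun b hb => hb.1) (by
      rintro b ⟨hb, hbx⟩ t k hk ht hsum s hs
      refine ⟨ht s hs, (hmem _).mpr fun hsx => (hmem hb).mp hbx ?_⟩
      refine hprime.mem_of_pow_mem (∑ s ∈ t, k s) ?_
      rw [← prod_reesMonomial_eq K hb t k ht hsum, ← Finset.mul_prod_erase t _ hs,
        reesMonomial_of_mem K (ht s hs)]
      exact Ideal.mul_mem_right _ _ (Ideal.pow_mem_of_mem _ hsx _ (hk s hs)))
  have hbA := mem_of_isNewtonVertex hb hv
  simp only [TopologicalSpace.Opens.mem_iSup]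
  exact ⟨b, hbA, hv, hbx⟩

theorem exists_spec_iso {R S : Type u} [CommRing R] [CommRing S] [Algebra K R] [Algebra K S]
    (f : R ≃ₐ[K] S) : ∃ e : Spec (CommRingCat.of R) ≅ Spec (CommRingCat.of S),
      e.hom ≫ Spec.map (CommRingCat.ofHom (algebraMap K S)) =
        Spec.map (CommRingCat.ofHom (algebraMap K R)) := by
  refine ⟨Scheme.Spec.mapIso f.toRingEquiv.toCommRingCatIso.symm.op, ?_⟩
  change Spec.map (CommRingCat.ofHom (f.symm : S →+* R)) ≫ _ = _
  rw [← Spec.map_comp, ← CommRingCat.ofHom_comp]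
  congr 2
  exact RingHom.ext fun r => f.symm.commutes r

theorem exists_monomialChart_iso_algebraicTorus (ha : a ∈ idealSupport (monomialIdeal K A))
    (h : NeighborsMem (idealSupport (monomialIdeal K A)) a) :
    ∃ e : (monomialChart K A a ha).toScheme ≅ algebraicTorus K n,
      e.hom ≫ algebraicTorusStructure K n = monomialChartStructure K A a ha := by
  obtain ⟨e, he⟩ := exists_monomialChart_iso K ha
  let f : AddMonoidAlgebra K (idealTangentCone A a) ≃ₐ[K] AddMonoidAlgebra K (Fin n → ℤ) :=
    AddMonoidAlgebra.domCongr K K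
      ((AddEquiv.addSubmonoidCongr (idealTangentCone_eq_top h)).trans AddSubmonoid.topEquiv)
  obtain ⟨e', he'⟩ := exists_spec_iso K f
  exact ⟨e ≪≫ e', (Category.assoc _ _ _).trans ((congrArg (e.hom ≫ ·) he').trans he)⟩

end Charts

theorem mainTheorem1 (K : Type u) [Field K] (n : ℕ) (A : Set (Fin n →₀ ℕ)) :
    -- (i) the charts at non-vertices are covered by the charts at vertices
    (∀ (a : Fin n →₀ ℕ) (ha : a ∈ A), ¬ IsNewtonVertex (monomialIdeal K A) a →
      monomialChart K A a (subset_idealSupport K ha) ≤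
        ⨆ (v : Fin n →₀ ℕ) (hv : v ∈ A) (_ : IsNewtonVertex (monomialIdeal K A) v),
          monomialChart K A v (subset_idealSupport K hv)) ∧
    -- (ii) smoothness of the charts at vertices
    (∀ (a : Fin n →₀ ℕ) (ha : a ∈ idealSupport (monomialIdeal K A)),
      IsNewtonVertex (monomialIdeal K A) a →
        (Smooth (monomialChartStructure K A a ha) ↔ IsSimplicial (idealTangentCone A a))) ∧
    -- (iii) simplicial ideal tangent cones at vertices
    (∀ a ∈ idealSupport (monomialIdeal K A),
      IsNewtonVertex (monomialIdeal K A) a → IsSimplicial (idealTangentCone A a) →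
        (∀ S : Finset (Fin n → ℤ), IsMinimalGeneratingSet S (idealTangentCone A a) →
          ∀ v ∈ S, IsPrimitiveVector v) ∧
        (idealTangentCone A a : Set (Fin n → ℤ)) =
          {v | latticeToReal v ∈ realTangentCone (newtonPolyhedron (monomialIdeal K A))
            (latticeToReal (toLattice a))}) ∧
    -- (iv) charts at interior support points
    (∀ (a : Fin n →₀ ℕ) (ha : a ∈ idealSupport (monomialIdeal K A)),
      NeighborsMem (idealSupport (monomialIdeal K A)) a →
        ∃ e : (monomialChart K A a ha).toScheme ≅ algebraicTorus K n,
          e.hom ≫ algebraicTorusStructure K n = monomialChartStructure K A a ha) := by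
  refine ⟨fun a ha _ => monomialChart_le_iSup K _, fun a ha hv => ?_, fun a ha hv h => ?_,
    fun a ha h => exists_monomialChart_iso_algebraicTorus K ha h⟩
  · rw [smooth_monomialChartStructure_iff]
    exact isSimplicial_iff_smooth K (isPointedMonoid_of_isNewtonVertex ha hv)
      (idealTangentCone_fg A a) (single_mem_idealTangentCone A a)
  · exact ⟨fun S hS v hv => isPrimitiveVector_of_isSimplicial h hS hv,
      idealTangentCone_eq_of_isSimplicial ha h⟩
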